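/- Let $\mathbb E_n$ be the space of positive definite real symmetric $n\times n$ matrices with the Riemannian metric $ds^2=\operatorname{tr}(dX\,X^{-1}\,dX\,X^{-1})$ and its geodesic distance $\rho$. A geodesic means a nonconstant complete directed geodesic, i.e. a geodesic considered up to changes of parameter $t\mapsto at+b$, $a>0$. The null pencil of a geodesic $\mu$ is the set of all geodesics $\nu$ such that for every $S\in\mathbb R$ $$\lim_{t\to+\infty}\ \inf_{s\ge S}\rho(\mu(t),\nu(s))=0 .$$ A boundary datum consists of: 1. a set $I=\{0=i_0<i_1<\dots<i_m=n\}\subset\{0,1,\dots,n\}$; 2. a point of the simplex $\Delta(I)$, i.e. a collection $\psi_1>\psi_2>\dots>\psi_m$ of real numbers, not all zero, defined up to a joint positive factor; 3. a flag $\mathbb R^n=W_0\supset W_1\supset\dots\supset W_m=0$ with $\operatorname{codim}W_k=i_k$, i.e. a point of $\mathcal F(I)$; 4. a family $(R_1,\dots,R_m)$ of positive definite quadratic forms, $R_k$ on $W_{k-1}/W_k$, defined up to the replacements $(R_1,\dots,R_m)\rightsquigarrow(e^{\psi_1 s}R_1,\dots,e^{\psi_m s}R_m)$, $s\in\mathbb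 R$. A geodesic $\mu$ with a fixed affine parameter $t$ determines a boundary datum as follows. Write $\mu(t)=g\,\mathrm{diag}(e^{\varphi_1t},\dots,e^{\varphi_nt})\,g^\top$ with $g\in\mathrm{GL}(n,\mathbb R)$ and $\varphi_1\ge\dots\ge\varphi_n$. Let $\psi_1>\dots>\psi_m$ be the distinct values of the $\varphi_i$, and let $I$ be such that $\varphi_i=\psi_k$ for $i_{k-1}<i\le i_k$. For large $t$ let $W_k(t)$ be the span of the eigenvectors of $\mu(t)$ corresponding to its $n-i_k$ smallest eigenvalues, and let $W_k=\lim_{t\to+\infty}W_k(t)$. Let $Q_t(v)=\frac12 v^\top\mu(t)v$. Identify $W_{k-1}(t)$ with $W_{k-1}$ by orthogonal operators tending to the identity. The limit as $t\to+\infty$ of $e^{-\psi_kt}\,Q_t|_{W_{k-1}(t)}$ is then a quadratic form on $W_{k-1}$ that is induced by a positive definite form $R_k$ on $W_{k-1}/W_k$. **Theorem.** For every $n$, each geodesic has exactly one boundary datum in this sense, the datum depends only on the null pencil of the geodesic, and the resulting map is a bijection from the set of all null pencils in $\mathbb E_n$ onto the set of all boundary data 1–4. -/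

import Mathlib

open Filter Topology

noncomputable section

namespace PosDefSpace

/-! ### The Riemannian manifold of positive definite matrices -/

/-- The Riemannian metric `tr (dX · X⁻¹ · dX · X⁻¹)` (as a bilinear form on tangent vectors `U`, `V`,
which are symmetric matrices) at the point `X`. -/
def metric {n : ℕ} (X U V : Matrix (Fin n) (Fin n) ℝ) : ℝ :=
  (U * X⁻¹ * V * X⁻¹).trace

/-- The velocity vector of a curve of matrices, computed entrywise. -/
def velocity {n : ℕ} (c : ℝ → Matrix (Fin n) (Fin n) ℝ) (t : ℝ) : Matrix (Fin n) (Fin n) ℝ :=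
  Matrix.of fun i j => deriv (fun s => c s i j) t

/-- The Riemannian length of a curve over the parameter interval `[0, 1]`. -/
def length {n : ℕ} (c : ℝ → Matrix (Fin n) (Fin n) ℝ) : ℝ :=
  ∫ t in (0 : ℝ)..1, Real.sqrt (metric (c t) (velocity c t) (velocity c t))

/-- `c` is a `C¹` curve which on `[0, 1]` runs in the space of positive definite matrices
from `X` to `Y`. -/
structure IsPath {n : ℕ} (X Y : Matrix (Fin n) (Fin n) ℝ)
    (c : ℝ → Matrix (Fin n) (Fin n) ℝ) : Prop where
  smooth : ∀ i j, ContDiff ℝ 1 fun t => c t i j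
  posDef : ∀ t ∈ Set.Icc (0 : ℝ) 1, (c t).PosDef
  source : c 0 = X
  target : c 1 = Y

/-- The Riemannian distance: the infimum of the lengths of curves joining two points. -/
def rho {n : ℕ} (X Y : Matrix (Fin n) (Fin n) ℝ) : ℝ :=
  sInf {L | ∃ c, IsPath X Y c ∧ L = length c}

/-- A nonconstant complete geodesic with an affine parameter.  The geodesic equation is
the Euler-Lagrange equation of the Lagrangian `½ metric X X' X'`, tested against all
directions `V`:  `d/dt (∂L/∂X' · V) = ∂L/∂X · V`. -/
structure ParamGeodesic (n : ℕ) where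
  toFun : ℝ → Matrix (Fin n) (Fin n) ℝ
  posDef : ∀ t, (toFun t).PosDef
  smooth : ∀ i j, ContDiff ℝ 2 fun t => toFun t i j
  geodesic_eq : ∀ V : Matrix (Fin n) (Fin n) ℝ, V.IsSymm → ∀ t : ℝ,
    HasDerivAt (fun s => metric (toFun s) (velocity toFun s) V)
      ((1 / 2) * deriv
        (fun ε : ℝ => metric (toFun t + ε • V) (velocity toFun t) (velocity toFun t)) 0) t
  nonconst : ∃ s t, toFun s ≠ toFun t

/-- Two parametrized geodesics represent one directed geodesic when they differ by an
orientation preserving affine change of the parameter. -/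
def directedSetoid (n : ℕ) : Setoid (ParamGeodesic n) where
  r μ ν := ∃ a b : ℝ, 0 < a ∧ ∀ t, ν.toFun t = μ.toFun (a * t + b)
  iseqv :=
    { refl := fun _ => ⟨1, 0, one_pos, fun t => by simp⟩
      symm := by
        rintro μ ν ⟨a, b, ha, h⟩
        refine ⟨a⁻¹, -(a⁻¹ * b), inv_pos.2 ha, fun t => ?_⟩
        rw [h]
        congr 1
        field_simp
        ring
      trans := by
        rintro μ ν κ ⟨a, b, ha, h⟩ ⟨a', b', ha', h'⟩
        refine ⟨a * a', a * b' + b, mul_pos ha ha', fun t => ?_⟩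
        rw [h', h]
        congr 1
        ring }

/-- Directed geodesics. -/
def DirectedGeodesic (n : ℕ) : Type := Quotient (directedSetoid n)

/-- The directed geodesic represented by a parametrized one. -/
def ParamGeodesic.toDirected {n : ℕ} (μ : ParamGeodesic n) : DirectedGeodesic n :=
  Quotient.mk (directedSetoid n) μ

/-- The distance from a point to the forward half `{ν(s) : s ≥ S}` of a directed geodesic. -/
def distForward {n : ℕ} (X : Matrix (Fin n) (Fin n) ℝ) (ν : ParamGeodesic n) (S : ℝ) : ℝ :=
  sInf {d | ∃ s, S ≤ s ∧ d = rho X (ν.toFun s)}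

/-- The distance from `μ(t)` to the directed geodesic `ν` tends to `0` as `t → +∞`.
Since geodesics are directed, the distance is taken to the forward halves of `ν`. -/
def NullAsymptotic {n : ℕ} (μ ν : ParamGeodesic n) : Prop :=
  ∀ S : ℝ, Tendsto (fun t => distForward (μ.toFun t) ν S) atTop (𝓝 0)

/-- The null pencil of `μ`, a set of directed geodesics. -/
def nullPencil {n : ℕ} (μ : ParamGeodesic n) : Set (DirectedGeodesic n) :=
  {N | ∃ ν : ParamGeodesic n, ν.toDirected = N ∧ NullAsymptotic μ ν}

/-- The space of all null pencils. -/
def NullPencil (n : ℕ) : Type :=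
  {P : Set (DirectedGeodesic n) // ∃ μ : ParamGeodesic n, nullPencil μ = P}

/-- The null pencil of `μ` as a point of the space of null pencils. -/
def ParamGeodesic.toNullPencil {n : ℕ} (μ : ParamGeodesic n) : NullPencil n :=
  ⟨nullPencil μ, μ, rfl⟩

/-! ### Boundary data

A subset `I = {0 = i₀ < i₁ < ⋯ < i_m = n}` of `{0, …, n}` is a term of Mathlib's
`CompositionAsSet n`; then `I.length = m`. -/

/-- The element `i_k` of `I`. -/
def cut {n : ℕ} (I : CompositionAsSet n) (k : Fin (I.length + 1)) : Fin (n + 1) :=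
  I.boundaries.orderEmbOfFin I.card_boundaries_eq_succ_length k

/-- Collections `ψ₁ > ⋯ > ψ_m`, not all zero. -/
def Speeds {n : ℕ} (I : CompositionAsSet n) : Type :=
  {ψ : Fin I.length → ℝ // StrictAnti ψ ∧ ψ ≠ 0}

/-- Proportionality of collections with a positive factor. -/
def speedsSetoid {n : ℕ} (I : CompositionAsSet n) : Setoid (Speeds I) where
  r ψ φ := ∃ a : ℝ, 0 < a ∧ ∀ k, φ.1 k = a * ψ.1 k
  iseqv :=
    { refl := fun _ => ⟨1, one_pos, fun k => by simp⟩
      symm := by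
        rintro ψ φ ⟨a, ha, h⟩
        exact ⟨a⁻¹, inv_pos.2 ha, fun k => by rw [h]; field_simp⟩
      trans := by
        rintro ψ φ χ ⟨a, ha, h⟩ ⟨b, hb, h'⟩
        exact ⟨b * a, mul_pos hb ha, fun k => by rw [h', h]; ring⟩ }

/-- The simplex `Δ(I)`. -/
def Simplex {n : ℕ} (I : CompositionAsSet n) : Type := Quotient (speedsSetoid I)

/-- The point of the simplex represented by a collection. -/
def Speeds.toSimplex {n : ℕ} {I : CompositionAsSet n} (ψ : Speeds I) : Simplex I :=
  Quotient.mk (speedsSetoid I) ψ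

/-- The flags `ℝⁿ = W₀ ⊃ W₁ ⊃ ⋯ ⊃ W_m = 0` with `codim W_k = i_k`. -/
def Flag {n : ℕ} (I : CompositionAsSet n) : Type :=
  {W : Fin (I.length + 1) → Submodule ℝ (Fin n → ℝ) //
    Antitone W ∧ ∀ k, Module.finrank ℝ (W k) + (cut I k : ℕ) = n}

/-- The `k`-th subquotient `W_k / W_{k+1}` of a flag, `0 ≤ k < m`. -/
abbrev Flag.Subquot {n : ℕ} {I : CompositionAsSet n} (W : Flag I) (k : Fin I.length) : Type :=
  (W.1 k.castSucc) ⧸ (W.1 k.succ).submoduleOf (W.1 k.castSucc)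

/-- Families of positive definite quadratic forms on the subquotients of a flag. -/
def Forms {n : ℕ} {I : CompositionAsSet n} (W : Flag I) : Type :=
  ∀ k : Fin I.length, {R : QuadraticForm ℝ (W.Subquot k) // R.PosDef}

/-- Two families of forms are equivalent with respect to the point `δ` of the simplex when
they differ by a rescaling `(e^{ψ₁ s}, …, e^{ψ_m s})`, where `ψ` represents `δ` and `s` is real
(replacing `ψ` by a proportional collection only changes `s`). -/
def formsSetoid {n : ℕ} {I : CompositionAsSet n} (δ : Simplex I) (W : Flag I) :
    Setoid (Forms W) where
  r R R' := ∃ ψ : Speeds I, ψ.toSimplex = δ ∧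
    ∃ s : ℝ, ∀ k, ∀ x : W.Subquot k, (R' k).1 x = Real.exp (ψ.1 k * s) * (R k).1 x
  iseqv :=
    { refl := by
        intro R
        obtain ⟨ψ, hψ⟩ := Quotient.exists_rep δ
        exact ⟨ψ, hψ, 0, fun k x => by simp⟩
      symm := by
        rintro R R' ⟨ψ, hψ, s, h⟩
        refine ⟨ψ, hψ, -s, fun k x => ?_⟩
        rw [h, ← mul_assoc, ← Real.exp_add]
        simp
      trans := by
        rintro R R' R'' ⟨ψ, hψ, s, h⟩ ⟨φ, hφ, s', h'⟩
        obtain ⟨a, -, ha⟩ : (speedsSetoid I).r ψ φ := Quotient.exact (hψ.trans hφ.symm)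
        refine ⟨ψ, hψ, s + a * s', fun k x => ?_⟩
        rw [h', h, ha, ← mul_assoc, ← Real.exp_add]
        congr 2
        ring }

/-- Families of forms up to rescaling. -/
def FormsClass {n : ℕ} {I : CompositionAsSet n} (δ : Simplex I) (W : Flag I) : Type :=
  Quotient (formsSetoid δ W)

/-- The boundary data: a subset, a point of its simplex, a flag, and a class of families of
positive definite forms on the subquotients of the flag. -/
structure BoundaryData (n : ℕ) where
  I : CompositionAsSet n
  δ : Simplex I
  W : Flag I
  R : FormsClass δ W

/-! ### The boundary data of a geodesic -/

/-- The velocity of `μ`, for the given parameter: `μ(t) = g diag(e^{φ_1 t}, …, e^{φ_n t}) gᵀ`, where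
the vector `φ` has the value `ψ_k` at the positions of the `k`-th block cut out by `I`. -/
def HasVelocity {n : ℕ} (μ : ParamGeodesic n) (I : CompositionAsSet n) (ψ : Speeds I) : Prop :=
  ∃ φ : Fin n → ℝ,
    (∀ (k : Fin I.length) (i : Fin n),
      (cut I k.castSucc : ℕ) ≤ i → (i : ℕ) < cut I k.succ → φ i = ψ.1 k) ∧
    ∃ g : GL (Fin n) ℝ, ∀ t : ℝ,
      μ.toFun t = (g : Matrix (Fin n) (Fin n) ℝ) *
        Matrix.diagonal (fun i => Real.exp (φ i * t)) * (g : Matrix (Fin n) (Fin n) ℝ).transpose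

/-- The quadratic form `½ ∑ x_{ij} v_i v_j`. -/
def quadForm {n : ℕ} (X : Matrix (Fin n) (Fin n) ℝ) (v : Fin n → ℝ) : ℝ :=
  (1 / 2) * ∑ i, ∑ j, X i j * v i * v j

/-- The span of the eigenvectors of `X` whose eigenvalues are not among the `d` largest ones:
at least `d` eigenvalues, counted with multiplicity, are strictly larger. -/
def spectralTail {n : ℕ} (X : Matrix (Fin n) (Fin n) ℝ) (d : ℕ) : Submodule ℝ (Fin n → ℝ) :=
  Submodule.span ℝ {v | ∃ l : ℝ, X.mulVec v = l • v ∧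
    d ≤ (X.charpoly.roots.filter fun l' => l < l').card}

/-- `μ` (with its parameter) has literal limit data `ψ`, `W`, `R`: its velocity is `ψ`; for every
`k` the subspaces `W_k(t)` spanned by the eigenvectors of `μ(t)` for the packets of eigenvalues after
the first `k` ones converge to `W_k`; and `e^{-ψ t}` times the restriction of the form of `μ(t)` to
`W_k(t)` converges to a form on `W_k` that is induced by the given form on `W_k / W_{k+1}`.
The convergence is understood after an identification of `W_k(t)` with `W_k` by
orthogonal operators `h(t)` tending to `1`. -/
def HasLimitData {n : ℕ} (μ : ParamGeodesic n) {I : CompositionAsSet n} (ψ : Speeds I)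
    (W : Flag I) (R : Forms W) : Prop :=
  HasVelocity μ I ψ ∧
  ∀ k : Fin I.length, ∃ h : ℝ → Matrix.orthogonalGroup (Fin n) ℝ,
    Tendsto (fun t => (h t : Matrix (Fin n) (Fin n) ℝ)) atTop (𝓝 1) ∧
    (∀ᶠ t in atTop,
      (spectralTail (μ.toFun t) (cut I k.castSucc)).map
        (Matrix.toLin' (h t : Matrix (Fin n) (Fin n) ℝ)) = W.1 k.castSucc) ∧
    ∀ v : W.1 k.castSucc,
      Tendsto
        (fun t => Real.exp (-(ψ.1 k * t)) * quadForm (μ.toFun t)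
          ((h t : Matrix (Fin n) (Fin n) ℝ)⁻¹.mulVec (v : Fin n → ℝ)))
        atTop (𝓝 ((R k).1 (Submodule.Quotient.mk v)))

/-- `b` is the boundary datum of the geodesic `μ`. -/
def HasBoundaryData {n : ℕ} (μ : ParamGeodesic n) (b : BoundaryData n) : Prop :=
  ∃ (ψ : Speeds b.I) (R : Forms b.W), HasLimitData μ ψ b.W R ∧
    ψ.toSimplex = b.δ ∧ Quotient.mk (formsSetoid b.δ b.W) R = b.R

end PosDefSpace

end

/-! In the Euler–Lagrange equation both occurrences of `X⁻¹` in the metric contribute equally, and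
the equation becomes the conservation law `X⁻¹ X' = const`. Integrating it and diagonalizing the
initial velocity shows that the geodesics are exactly the curves `g diag(e^{φ_i t}) gᵀ` with `φ ≠ 0`
(`exists_paramGeodesic`, `ParamGeodesic.exists_eq_expCurve`). The rows of `gᵀ`, grouped into blocks
of equal `φ_i`, are coordinates adapted to a flag with forms on its subquotients. Such a `g` is
called a frame (`IsFrame`); every `g` is a frame of something, and every flag with forms has a frame
(`exists_isFrame`, `exists_frame`). This gives each geodesic a datum and realizes each datum by a
geodesic.

A datum is an invariant of null asymptoticity because `X ↦ log Q_X(v)` is 1-Lipschitz for `rho`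
(`log_quadForm_sub_le_rho`). Along a geodesic, `log Q(v) = ψ_k t + log R_k(v) + o(1)` for `v` in
`W_k` outside `W_{k+1}`. If two geodesics approach each other along sequences of times, comparing
these expansions for all `v` gives proportional speeds, equal flags and forms that agree up to the
permitted rescaling (`IsModel.compare`, `IsDatum.eq_of_asymptotic`).

Conversely, let two geodesics have the same datum. The transition matrix between their frames is
block triangular. After moving `μ(t)` to the identity by `g diag(e^{φ_i t/2})`, its off-diagonal
blocks decay and its diagonal blocks are isometries of the forms up to the rescaling, so the second
geodesic, suitably reparametrized, tends to the identity too (`IsFrame.tendsto_rho`).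

It remains to see that the datum read off from a frame is the one defined by spectral limits. A
min-max comparison of the eigenvalues of `μ(t)` with `e^{φ_i t}` (`exists_spectral_bound`) shows
that vectors of the spectral subspaces have exponentially small coordinates in the earlier blocks.
So these subspaces converge to the flag, and the rescaled forms converge to those of the frame
(`tendsto_of_mem_spectralTail`, `hasBoundaryData_iff`). -/

noncomputable section

namespace PosDefSpace

open Matrix

variable {n : ℕ}

/-! ### Entrywise calculus of matrix curves -/

/-- The matrix curve `X` has the entrywise derivative `X'` at `t`. -/
def HasMatDeriv (X : ℝ → Matrix (Fin n) (Fin n) ℝ) (X' : Matrix (Fin n) (Fin n) ℝ) (t : ℝ) : Prop :=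
  ∀ i j, HasDerivAt (fun s => X s i j) (X' i j) t

theorem tendsto_matrix_iff {α : Type*} {l : Filter α} {f : α → Matrix (Fin n) (Fin n) ℝ}
    {A : Matrix (Fin n) (Fin n) ℝ} :
    Tendsto f l (𝓝 A) ↔ ∀ i j, Tendsto (fun a => f a i j) l (𝓝 (A i j)) := by
  constructor
  · intro h i j
    exact ((continuous_id.matrix_elem i j).tendsto A).comp h
  · intro h
    exact tendsto_pi_nhds.2 fun i => tendsto_pi_nhds.2 fun j => h i j

/-- Passing to matrix difference quotients allows the derivative of the inverse to be computed by
matrix algebra instead of entry by entry. -/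
theorem hasMatDeriv_iff_tendsto {X : ℝ → Matrix (Fin n) (Fin n) ℝ}
    {X' : Matrix (Fin n) (Fin n) ℝ} {t : ℝ} :
    HasMatDeriv X X' t ↔ Tendsto (fun s => (s - t)⁻¹ • (X s - X t)) (𝓝[≠] t) (𝓝 X') := by
  rw [tendsto_matrix_iff]
  refine forall_congr' fun i => forall_congr' fun j => ?_
  rw [hasDerivAt_iff_tendsto_slope]
  rfl

theorem hasMatDeriv_const (A : Matrix (Fin n) (Fin n) ℝ) (t : ℝ) :
    HasMatDeriv (fun _ => A) 0 t := fun _ _ => hasDerivAt_const _ _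

theorem HasMatDeriv.mul {X Y : ℝ → Matrix (Fin n) (Fin n) ℝ} {X' Y' : Matrix (Fin n) (Fin n) ℝ}
    {t : ℝ} (hX : HasMatDeriv X X' t) (hY : HasMatDeriv Y Y' t) :
    HasMatDeriv (fun s => X s * Y s) (X' * Y t + X t * Y') t := by
  intro i j
  simp only [Matrix.mul_apply, Matrix.add_apply, ← Finset.sum_add_distrib]
  exact HasDerivAt.fun_sum fun k _ => (hX i k).mul (hY k j)

theorem HasMatDeriv.const_mul {Y : ℝ → Matrix (Fin n) (Fin n) ℝ} {Y' : Matrix (Fin n) (Fin n) ℝ}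
    {t : ℝ} (A : Matrix (Fin n) (Fin n) ℝ) (hY : HasMatDeriv Y Y' t) :
    HasMatDeriv (fun s => A * Y s) (A * Y') t := by
  simpa using (hasMatDeriv_const A t).mul hY

theorem HasMatDeriv.mul_const {X : ℝ → Matrix (Fin n) (Fin n) ℝ} {X' : Matrix (Fin n) (Fin n) ℝ}
    {t : ℝ} (hX : HasMatDeriv X X' t) (A : Matrix (Fin n) (Fin n) ℝ) :
    HasMatDeriv (fun s => X s * A) (X' * A) t := by
  simpa using hX.mul (hasMatDeriv_const A t)

theorem HasMatDeriv.trace {X : ℝ → Matrix (Fin n) (Fin n) ℝ} {X' : Matrix (Fin n) (Fin n) ℝ}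
    {t : ℝ} (hX : HasMatDeriv X X' t) : HasDerivAt (fun s => (X s).trace) X'.trace t :=
  HasDerivAt.fun_sum fun k _ => hX k k

theorem HasMatDeriv.tendsto {X : ℝ → Matrix (Fin n) (Fin n) ℝ} {X' : Matrix (Fin n) (Fin n) ℝ}
    {t : ℝ} (hX : HasMatDeriv X X' t) : Tendsto X (𝓝 t) (𝓝 (X t)) :=
  tendsto_matrix_iff.2 fun i j => (hX i j).continuousAt.tendsto

theorem tendsto_inv {α : Type*} {l : Filter α} {f : α → Matrix (Fin n) (Fin n) ℝ}
    {A : Matrix (Fin n) (Fin n) ℝ} (hA : IsUnit A) (h : Tendsto f l (𝓝 A)) :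
    Tendsto (fun a => (f a)⁻¹) l (𝓝 A⁻¹) := by
  simp only [Matrix.inv_def, Ring.inverse_eq_inv']
  have hd : A.det ≠ 0 := ((Matrix.isUnit_iff_isUnit_det _).1 hA).ne_zero
  exact (((continuous_id.matrix_det.tendsto A).comp h).inv₀ hd).smul
    ((continuous_id.matrix_adjugate.tendsto A).comp h)

/-- This is the limit of the resolvent identity `X(s)⁻¹ - X(t)⁻¹ = -X(s)⁻¹ (X(s) - X(t)) X(t)⁻¹`,
divided by `s - t`. -/
theorem HasMatDeriv.inv {X : ℝ → Matrix (Fin n) (Fin n) ℝ} {X' : Matrix (Fin n) (Fin n) ℝ}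
    {t : ℝ} (hX : HasMatDeriv X X' t) (hu : ∀ᶠ s in 𝓝 t, IsUnit (X s)) :
    HasMatDeriv (fun s => (X s)⁻¹) (-((X t)⁻¹ * X' * (X t)⁻¹)) t := by
  have h1 := hasMatDeriv_iff_tendsto.1 hX
  have h2 : Tendsto (fun s => (X s)⁻¹) (𝓝[≠] t) (𝓝 (X t)⁻¹) :=
    (tendsto_inv hu.self_of_nhds hX.tendsto).mono_left nhdsWithin_le_nhds
  rw [hasMatDeriv_iff_tendsto]
  refine (((h2.mul h1).mul (tendsto_const_nhds (x := (X t)⁻¹))).neg).congr' ?_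
  filter_upwards [nhdsWithin_le_nhds hu] with s hs
  have e1 := Matrix.nonsing_inv_mul _ ((Matrix.isUnit_iff_isUnit_det _).1 hs)
  have e2 := Matrix.mul_nonsing_inv _ ((Matrix.isUnit_iff_isUnit_det _).1 hu.self_of_nhds)
  rw [Matrix.mul_smul, Matrix.smul_mul, ← smul_neg, Matrix.mul_sub, Matrix.sub_mul, e1, Matrix.one_mul,
    Matrix.mul_assoc (X s)⁻¹, e2, Matrix.mul_one, neg_sub]

theorem HasMatDeriv.velocity {X : ℝ → Matrix (Fin n) (Fin n) ℝ} {X' : Matrix (Fin n) (Fin n) ℝ}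
    {t : ℝ} (hX : HasMatDeriv X X' t) : velocity X t = X' := by
  ext i j
  exact (hX i j).deriv

theorem hasMatDeriv_velocity {X : ℝ → Matrix (Fin n) (Fin n) ℝ}
    (hX : ∀ i j, ContDiff ℝ 1 fun t => X t i j) (t : ℝ) : HasMatDeriv X (velocity X t) t :=
  fun i j => ((hX i j).differentiable one_ne_zero t).hasDerivAt

theorem HasMatDeriv.isSymm {X : ℝ → Matrix (Fin n) (Fin n) ℝ} {X' : Matrix (Fin n) (Fin n) ℝ}
    {t : ℝ} (hX : HasMatDeriv X X' t) (hs : ∀ᶠ s in 𝓝 t, (X s).IsSymm) : X'.IsSymm := by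
  ext i j
  refine (hX j i).unique ((hX i j).congr_of_eventuallyEq ?_)
  filter_upwards [hs] with s hs
  exact hs.apply i j

theorem PosDef.isSymm {X : Matrix (Fin n) (Fin n) ℝ} (hX : X.PosDef) : X.IsSymm := by
  have := hX.isHermitian
  rwa [Matrix.IsHermitian, Matrix.conjTranspose_eq_transpose_of_trivial] at this

/-! ### Factorizations -/

/-- A symmetric matrix has the spectral decomposition with eigenvalues in decreasing order. -/
theorem exists_sorted_spectral {X : Matrix (Fin n) (Fin n) ℝ} (hX : X.IsSymm) :
    ∃ (U : Matrix (Fin n) (Fin n) ℝ) (l : Fin n → ℝ), Antitone l ∧ Uᵀ * U = 1 ∧ U * Uᵀ = 1 ∧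
      X = U * Matrix.diagonal l * Uᵀ := by
  have hH : X.IsHermitian := by
    rwa [Matrix.IsHermitian, Matrix.conjTranspose_eq_transpose_of_trivial]
  set U0 : Matrix (Fin n) (Fin n) ℝ := hH.eigenvectorUnitary.1 with hU0
  have hs := hH.spectral_theorem
  rw [Unitary.conjStarAlgAut_apply] at hs
  have hstar : star U0 = U0ᵀ := by
    rw [Matrix.star_eq_conjTranspose, Matrix.conjTranspose_eq_transpose_of_trivial]
  have h1 : U0ᵀ * U0 = 1 := by rw [← hstar]; exact Unitary.coe_star_mul_self hH.eigenvectorUnitary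
  have h2 : U0 * U0ᵀ = 1 := by rw [← hstar]; exact Unitary.coe_mul_star_self hH.eigenvectorUnitary
  set σ := Tuple.sort (fun i => -hH.eigenvalues i)
  have hσ := Tuple.monotone_sort (fun i => -hH.eigenvalues i)
  refine ⟨U0.submatrix id σ, hH.eigenvalues ∘ σ, ?_, ?_, ?_, ?_⟩
  · intro i j hij
    have := hσ hij
    simpa using this
  · rw [Matrix.transpose_submatrix, ← Matrix.submatrix_mul _ _ _ _ _ Function.bijective_id, h1]
    simp
  · rw [Matrix.transpose_submatrix, Matrix.submatrix_mul_equiv, h2]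
    simp
  · have e : Matrix.diagonal (hH.eigenvalues ∘ σ) =
        (Matrix.diagonal hH.eigenvalues).submatrix σ σ := by
      rw [Matrix.submatrix_diagonal_equiv]
    rw [e, Matrix.transpose_submatrix, Matrix.submatrix_mul_equiv, Matrix.submatrix_mul_equiv]
    rw [← hstar]
    simpa using hs

theorem exists_sorted_spectral_posDef {X : Matrix (Fin n) (Fin n) ℝ} (hX : X.PosDef) :
    ∃ (U : Matrix (Fin n) (Fin n) ℝ) (l : Fin n → ℝ), Antitone l ∧ (∀ i, 0 < l i) ∧ Uᵀ * U = 1 ∧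
      U * Uᵀ = 1 ∧ X = U * Matrix.diagonal l * Uᵀ := by
  obtain ⟨U, l, hl, h1, h2, h⟩ := exists_sorted_spectral (PosDef.isSymm hX)
  refine ⟨U, l, hl, fun i => ?_, h1, h2, h⟩
  have hd : Matrix.diagonal l = Uᵀ * X * U := by
    rw [h]
    simp only [← Matrix.mul_assoc, h1, Matrix.one_mul]
    rw [Matrix.mul_assoc, h1, Matrix.mul_one]
  have hp : (Matrix.diagonal l).PosDef := by
    rw [hd, ← Matrix.conjTranspose_eq_transpose_of_trivial]
    refine hX.conjTranspose_mul_mul_same fun v w hvw => ?_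
    simpa [h1] using congrArg (Uᵀ *ᵥ ·) hvw
  simpa using hp.diag_pos (i := i)

theorem exists_eq_mul_transpose {X : Matrix (Fin n) (Fin n) ℝ} (hX : X.PosDef) :
    ∃ g : GL (Fin n) ℝ, X = (g : Matrix (Fin n) (Fin n) ℝ) * (g : Matrix (Fin n) (Fin n) ℝ)ᵀ := by
  obtain ⟨U, l, -, hl, h1, h2, h⟩ := exists_sorted_spectral_posDef hX
  have hsq : Matrix.diagonal (fun i => √(l i)) * Matrix.diagonal (fun i => √(l i)) =
      Matrix.diagonal l := by
    rw [Matrix.diagonal_mul_diagonal]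
    congr 1
    ext i
    exact Real.mul_self_sqrt (hl i).le
  have hfac : X = (U * Matrix.diagonal (fun i => √(l i))) *
      (U * Matrix.diagonal (fun i => √(l i)))ᵀ := by
    rw [h, ← hsq, Matrix.transpose_mul, Matrix.diagonal_transpose]
    simp only [Matrix.mul_assoc]
  have hdet : IsUnit (U * Matrix.diagonal (fun i => √(l i))) := by
    have hX' := hX.isUnit
    rw [hfac, Matrix.isUnit_iff_isUnit_det, Matrix.det_mul] at hX'
    rw [Matrix.isUnit_iff_isUnit_det]
    exact isUnit_of_mul_isUnit_left hX'
  obtain ⟨g, hg⟩ := hdet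
  exact ⟨g, by rw [hg]; exact hfac⟩

/-! ### Geodesics -/

/-- The force term of the geodesic equation. Each of the two factors `X⁻¹` is differentiated, and
cyclicity of the trace makes both contributions equal. -/
theorem deriv_metric_add_smul {X V B : Matrix (Fin n) (Fin n) ℝ} (hX : IsUnit X) :
    deriv (fun ε : ℝ => metric (X + ε • V) B B) 0 =
      -2 * (B * X⁻¹ * B * X⁻¹ * V * X⁻¹).trace := by
  have hY : HasMatDeriv (fun ε : ℝ => X + ε • V) V 0 := by
    intro i j
    simpa using ((hasDerivAt_id (0 : ℝ)).mul_const (V i j)).const_add (X i j)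
  have hu : ∀ᶠ ε in 𝓝 (0 : ℝ), IsUnit (X + ε • V) := by
    have hc : Tendsto (fun ε : ℝ => (X + ε • V).det) (𝓝 0) (𝓝 (X + (0 : ℝ) • V).det) :=
      (continuous_id.matrix_det.tendsto _).comp hY.tendsto
    rw [zero_smul, add_zero] at hc
    have hd : X.det ≠ 0 := ((Matrix.isUnit_iff_isUnit_det _).1 hX).ne_zero
    filter_upwards [hc.eventually_ne hd] with ε hε
    exact (Matrix.isUnit_iff_isUnit_det _).2 hε.isUnit
  have hI := hY.inv hu
  have hm := (((hI.const_mul B).mul_const B).mul hI).trace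
  have he : (fun ε : ℝ => metric (X + ε • V) B B) =
      fun s => (B * (X + s • V)⁻¹ * B * (X + s • V)⁻¹).trace := rfl
  rw [he, hm.deriv]
  simp only [zero_smul, add_zero, Matrix.trace_add, Matrix.mul_neg, Matrix.neg_mul,
    Matrix.trace_neg]
  have e1 : (B * (X⁻¹ * V * X⁻¹) * B * X⁻¹).trace = (B * X⁻¹ * B * X⁻¹ * V * X⁻¹).trace := by
    have := Matrix.trace_mul_comm (B * X⁻¹ * V * X⁻¹) (B * X⁻¹)
    simp only [← Matrix.mul_assoc] at this ⊢
    exact this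
  rw [e1]
  simp only [← Matrix.mul_assoc]
  ring

theorem eventually_isUnit_of_posDef {X : ℝ → Matrix (Fin n) (Fin n) ℝ}
    (h : ∀ t, (X t).PosDef) (t : ℝ) : ∀ᶠ s in 𝓝 t, IsUnit (X s) :=
  Eventually.of_forall fun s => (h s).isUnit

/-- The curve `g diag(e^{φ_1 t}, …, e^{φ_n t}) gᵀ`. -/
def expCurve (g : GL (Fin n) ℝ) (φ : Fin n → ℝ) (t : ℝ) : Matrix (Fin n) (Fin n) ℝ :=
  (g : Matrix (Fin n) (Fin n) ℝ) * Matrix.diagonal (fun i => Real.exp (φ i * t)) *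
    (g : Matrix (Fin n) (Fin n) ℝ)ᵀ

theorem hasMatDeriv_diagonal_exp (φ : Fin n → ℝ) (t : ℝ) :
    HasMatDeriv (fun t => Matrix.diagonal (fun i => Real.exp (φ i * t)))
      (Matrix.diagonal φ * Matrix.diagonal (fun i => Real.exp (φ i * t))) t := by
  intro i j
  rw [Matrix.diagonal_mul_diagonal]
  by_cases h : i = j
  · subst h
    simp only [Matrix.diagonal_apply_eq]
    have := ((hasDerivAt_id t).const_mul (φ i)).exp
    simpa [mul_comm] using this
  · simp only [Matrix.diagonal_apply_ne _ h]
    exact hasDerivAt_const _ _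

theorem gl_inv_mul (g : GL (Fin n) ℝ) :
    (g : Matrix (Fin n) (Fin n) ℝ)⁻¹ * (g : Matrix (Fin n) (Fin n) ℝ) = 1 :=
  Matrix.nonsing_inv_mul _ ((Matrix.isUnit_iff_isUnit_det _).1 g.isUnit)

theorem gl_mul_inv (g : GL (Fin n) ℝ) :
    (g : Matrix (Fin n) (Fin n) ℝ) * (g : Matrix (Fin n) (Fin n) ℝ)⁻¹ = 1 :=
  Matrix.mul_nonsing_inv _ ((Matrix.isUnit_iff_isUnit_det _).1 g.isUnit)

theorem gl_transpose_mul_inv (g : GL (Fin n) ℝ) :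
    (g : Matrix (Fin n) (Fin n) ℝ)ᵀ * (g : Matrix (Fin n) (Fin n) ℝ)⁻¹ᵀ = 1 := by
  rw [← Matrix.transpose_mul, gl_inv_mul, Matrix.transpose_one]

theorem gl_transpose_inv_mul (g : GL (Fin n) ℝ) :
    (g : Matrix (Fin n) (Fin n) ℝ)⁻¹ᵀ * (g : Matrix (Fin n) (Fin n) ℝ)ᵀ = 1 := by
  rw [← Matrix.transpose_mul, gl_mul_inv, Matrix.transpose_one]

theorem gl_transpose_mulVec_injective (g : GL (Fin n) ℝ) :
    Function.Injective ((g : Matrix (Fin n) (Fin n) ℝ)ᵀ *ᵥ ·) := by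
  intro v w h
  have h' := congrArg ((g : Matrix (Fin n) (Fin n) ℝ)⁻¹ᵀ *ᵥ ·) h
  simp only [Matrix.mulVec_mulVec, gl_transpose_inv_mul, Matrix.one_mulVec] at h'
  exact h'

theorem posDef_expCurve (g : GL (Fin n) ℝ) (φ : Fin n → ℝ) (t : ℝ) : (expCurve g φ t).PosDef := by
  have hd : (Matrix.diagonal (fun i => Real.exp (φ i * t))).PosDef :=
    Matrix.PosDef.diagonal fun i => Real.exp_pos _
  have h := hd.conjTranspose_mul_mul_same (B := (g : Matrix (Fin n) (Fin n) ℝ)ᵀ)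
    (gl_transpose_mulVec_injective g)
  rwa [Matrix.conjTranspose_eq_transpose_of_trivial, Matrix.transpose_transpose] at h

theorem hasMatDeriv_expCurve (g : GL (Fin n) ℝ) (φ : Fin n → ℝ) (t : ℝ) :
    HasMatDeriv (expCurve g φ) ((g : Matrix (Fin n) (Fin n) ℝ) * Matrix.diagonal φ *
      (g : Matrix (Fin n) (Fin n) ℝ)⁻¹ * expCurve g φ t) t := by
  have h := ((hasMatDeriv_diagonal_exp φ t).const_mul
    (g : Matrix (Fin n) (Fin n) ℝ)).mul_const (g : Matrix (Fin n) (Fin n) ℝ)ᵀ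
  have e : (g : Matrix (Fin n) (Fin n) ℝ) * Matrix.diagonal φ * (g : Matrix (Fin n) (Fin n) ℝ)⁻¹ *
      expCurve g φ t = (g : Matrix (Fin n) (Fin n) ℝ) * (Matrix.diagonal φ *
        Matrix.diagonal (fun i => Real.exp (φ i * t))) * (g : Matrix (Fin n) (Fin n) ℝ)ᵀ := by
    rw [expCurve]
    simp only [← Matrix.mul_assoc]
    rw [Matrix.mul_assoc _ _ (g : Matrix (Fin n) (Fin n) ℝ), gl_inv_mul, Matrix.mul_one]
  rw [e]
  exact h

theorem expCurve_zero (g : GL (Fin n) ℝ) (φ : Fin n → ℝ) :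
    expCurve g φ 0 = (g : Matrix (Fin n) (Fin n) ℝ) * (g : Matrix (Fin n) (Fin n) ℝ)ᵀ := by
  simp [expCurve]

theorem gl_conj_cancel (g : GL (Fin n) ℝ) {A B : Matrix (Fin n) (Fin n) ℝ}
    (h : (g : Matrix (Fin n) (Fin n) ℝ) * A * (g : Matrix (Fin n) (Fin n) ℝ)ᵀ =
      (g : Matrix (Fin n) (Fin n) ℝ) * B * (g : Matrix (Fin n) (Fin n) ℝ)ᵀ) : A = B := by
  have := congrArg (fun M => (g : Matrix (Fin n) (Fin n) ℝ)⁻¹ * M *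
    (g : Matrix (Fin n) (Fin n) ℝ)⁻¹ᵀ) h
  beta_reduce at this
  rw [← Matrix.mul_assoc, ← Matrix.mul_assoc, ← Matrix.mul_assoc, ← Matrix.mul_assoc, gl_inv_mul,
    Matrix.one_mul, Matrix.one_mul, Matrix.mul_assoc, Matrix.mul_assoc, gl_transpose_mul_inv,
    Matrix.mul_one, Matrix.mul_one] at this
  exact this

theorem contDiff_expCurve {m : WithTop ℕ∞} (g : GL (Fin n) ℝ) (φ : Fin n → ℝ) (i j : Fin n) :
    ContDiff ℝ m fun t => expCurve g φ t i j := by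
  simp only [expCurve, Matrix.mul_apply (N := (g : Matrix (Fin n) (Fin n) ℝ)ᵀ), Matrix.mul_diagonal]
  fun_prop

/-- The curves `g diag(e^{φ_1 t}, …, e^{φ_n t}) gᵀ`, `φ ≠ 0`, are geodesics. -/
theorem exists_paramGeodesic (g : GL (Fin n) ℝ) {φ : Fin n → ℝ} (hφ : φ ≠ 0) :
    ∃ μ : ParamGeodesic n, μ.toFun = expCurve g φ := by
  refine ⟨⟨expCurve g φ, posDef_expCurve g φ, contDiff_expCurve g φ, fun V _ t => ?_, 0, 1, fun h => ?_⟩, rfl⟩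
  · set N : Matrix (Fin n) (Fin n) ℝ := (g : Matrix (Fin n) (Fin n) ℝ) * Matrix.diagonal φ *
      (g : Matrix (Fin n) (Fin n) ℝ)⁻¹ with hN
    have hv : ∀ s, velocity (expCurve g φ) s = N * expCurve g φ s :=
      fun s => (hasMatDeriv_expCurve g φ s).velocity
    have hX : ∀ s, expCurve g φ s * (expCurve g φ s)⁻¹ = 1 := fun s =>
      Matrix.mul_nonsing_inv _ ((Matrix.isUnit_iff_isUnit_det _).1 (posDef_expCurve g φ s).isUnit)
    have hXa : ∀ s (A : Matrix (Fin n) (Fin n) ℝ),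
        expCurve g φ s * ((expCurve g φ s)⁻¹ * A) = A := fun s A => by
      rw [← Matrix.mul_assoc, hX, Matrix.one_mul]
    have hinv := (hasMatDeriv_expCurve g φ t).inv
      (eventually_isUnit_of_posDef (posDef_expCurve g φ) t)
    -- Since `X' = N X` with constant `N`, the momentum is `tr(N V X⁻¹)`, and only the inverse has
    -- to be differentiated.
    have hm : (fun s => metric (expCurve g φ s) (velocity (expCurve g φ) s) V) =
        fun s => (N * V * (expCurve g φ s)⁻¹).trace := by
      ext s
      rw [metric, hv, Matrix.mul_assoc N, hX, Matrix.mul_one]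
    rw [hm, deriv_metric_add_smul (posDef_expCurve g φ t).isUnit, hv]
    convert (hinv.const_mul (N * V)).trace using 1
    simp only [← hN, Matrix.mul_neg, Matrix.trace_neg]
    have e1 : N * expCurve g φ t * (expCurve g φ t)⁻¹ * (N * expCurve g φ t) *
        (expCurve g φ t)⁻¹ * V * (expCurve g φ t)⁻¹ = N * (N * V * (expCurve g φ t)⁻¹) := by
      simp only [Matrix.mul_assoc, hXa]
    have e2 : N * V * ((expCurve g φ t)⁻¹ * (N * expCurve g φ t) * (expCurve g φ t)⁻¹) =
        (N * V * (expCurve g φ t)⁻¹) * N := by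
      simp only [Matrix.mul_assoc, hX, Matrix.mul_one]
    rw [e1, e2, Matrix.trace_mul_comm N]
    ring
  · refine hφ (funext fun i => ?_)
    have := congrFun (congrFun (gl_conj_cancel g h) i) i
    simpa using this.symm

theorem eq_of_hasMatDeriv_zero {X : ℝ → Matrix (Fin n) (Fin n) ℝ}
    (h : ∀ t, HasMatDeriv X 0 t) (t : ℝ) : X t = X 0 := by
  ext i j
  exact is_const_of_deriv_eq_zero (fun s => (h s i j).differentiableAt) (fun s => (h s i j).deriv) t 0

/-- A curve of symmetric matrices is differentiable if its traces against symmetric matrices are. -/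
theorem hasMatDeriv_of_trace {Y : ℝ → Matrix (Fin n) (Fin n) ℝ} {Z : Matrix (Fin n) (Fin n) ℝ}
    {t : ℝ} (hY : ∀ s, (Y s).IsSymm) (hZ : Z.IsSymm)
    (h : ∀ V : Matrix (Fin n) (Fin n) ℝ, V.IsSymm →
      HasDerivAt (fun s => (Y s * V).trace) (Z * V).trace t) : HasMatDeriv Y Z t := by
  intro i j
  -- The symmetrized matrix unit is an admissible test direction; against a symmetric matrix it
  -- returns twice an entry, also when `i = j`.
  have hV : (Matrix.single i j (1 : ℝ) + Matrix.single j i 1).IsSymm := by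
    rw [Matrix.IsSymm, Matrix.transpose_add, Matrix.transpose_single, Matrix.transpose_single,
      add_comm]
  have e : ∀ M : Matrix (Fin n) (Fin n) ℝ, M.IsSymm →
      (M * (Matrix.single i j (1 : ℝ) + Matrix.single j i 1)).trace = 2 * M i j := by
    intro M hM
    rw [Matrix.mul_add, Matrix.trace_add, Matrix.trace_mul_comm, Matrix.trace_mul_comm M,
      Matrix.trace_single_mul, Matrix.trace_single_mul]
    have := hM.apply i j
    simp only [one_mul, smul_eq_mul]
    linarith
  have h1 := h _ hV
  simp only [e _ hZ, e _ (hY _)] at h1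
  have := h1.const_mul (1 / 2 : ℝ)
  simpa using this

/-- Every geodesic is of the form `g diag(e^{φ_1 t}, …, e^{φ_n t}) gᵀ`. -/
theorem ParamGeodesic.exists_eq_expCurve (μ : ParamGeodesic n) :
    ∃ (g : GL (Fin n) ℝ) (φ : Fin n → ℝ), Antitone φ ∧ φ ≠ 0 ∧ μ.toFun = expCurve g φ := by
  set X := μ.toFun with hX
  have hu : ∀ t, IsUnit (X t) := fun t => (μ.posDef t).isUnit
  have hd : ∀ t, HasMatDeriv X (velocity X t) t :=
    hasMatDeriv_velocity fun i j => (μ.smooth i j).of_le (by norm_num)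
  have hsym : ∀ t, (X t).IsSymm := fun t => PosDef.isSymm (μ.posDef t)
  have hsymi : ∀ t, ((X t)⁻¹).IsSymm := fun t => PosDef.isSymm (μ.posDef t).inv
  have hvsym : ∀ t, (velocity X t).IsSymm := fun t => (hd t).isSymm (Eventually.of_forall hsym)
  have e1 : ∀ t, (X t)⁻¹ * X t = 1 := fun t =>
    Matrix.nonsing_inv_mul _ ((Matrix.isUnit_iff_isUnit_det _).1 (hu t))
  -- The geodesic equation freed from its test directions: the momentum `X⁻¹ X' X⁻¹` has derivative
  -- `-X⁻¹ X' X⁻¹ X' X⁻¹`.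
  have hY : ∀ t, HasMatDeriv (fun s => (X s)⁻¹ * velocity X s * (X s)⁻¹)
      (-((X t)⁻¹ * velocity X t * (X t)⁻¹ * velocity X t * (X t)⁻¹)) t := by
    intro t
    refine hasMatDeriv_of_trace (fun s => ?_) ?_ fun V hV => ?_
    · rw [Matrix.IsSymm, Matrix.transpose_mul, Matrix.transpose_mul, (hsymi s).eq, (hvsym s).eq,
        Matrix.mul_assoc]
    · rw [Matrix.IsSymm]
      simp only [Matrix.transpose_neg, Matrix.transpose_mul, (hsymi t).eq, (hvsym t).eq,
        Matrix.mul_assoc]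
    · have h := μ.geodesic_eq V hV t
      rw [deriv_metric_add_smul (hu t)] at h
      convert h using 1
      · ext s
        rw [metric, ← hX, Matrix.trace_mul_comm _ (X s)⁻¹]
        simp only [Matrix.mul_assoc]
      · have e : (-((X t)⁻¹ * velocity X t * (X t)⁻¹ * velocity X t * (X t)⁻¹) * V).trace =
            -((X t)⁻¹ * (velocity X t * (X t)⁻¹ * velocity X t * (X t)⁻¹ * V)).trace := by
          rw [Matrix.neg_mul, Matrix.trace_neg]
          simp only [Matrix.mul_assoc]
        rw [e, Matrix.trace_mul_comm, ← hX]
        ring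
  set M := (X 0)⁻¹ * velocity X 0 with hM
  -- Conservation law: `X⁻¹ X'` is the momentum times `X`, and by the product rule its derivative
  -- vanishes.
  have hM' : ∀ t, (X t)⁻¹ * velocity X t = M := by
    intro t
    have h0 : ∀ s, HasMatDeriv (fun s => (X s)⁻¹ * velocity X s * (X s)⁻¹ * X s) 0 s := by
      intro s
      have h := (hY s).mul (hd s)
      convert h using 1
      rw [Matrix.neg_mul, Matrix.mul_assoc _ _ (X s), e1, Matrix.mul_one, neg_add_cancel]
    have := eq_of_hasMatDeriv_zero h0 t
    simpa only [Matrix.mul_assoc, e1, Matrix.mul_one, hM] using this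
  have hvel : ∀ t, velocity X t = X t * M := by
    intro t
    rw [← hM' t, ← Matrix.mul_assoc,
      Matrix.mul_nonsing_inv _ ((Matrix.isUnit_iff_isUnit_det _).1 (hu t)), Matrix.one_mul]
  obtain ⟨p, hp⟩ := exists_eq_mul_transpose (μ.posDef 0)
  rw [← hX] at hp
  set P : Matrix (Fin n) (Fin n) ℝ := p.1 with hP
  -- After `X 0` is moved to the identity by `P`, the initial velocity is symmetric and can be
  -- diagonalized orthogonally. This gives `X 0 = G Gᵀ` and `X' 0 = G diag(φ) Gᵀ` simultaneously.
  have hS : (P⁻¹ * velocity X 0 * P⁻¹ᵀ).IsSymm := by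
    rw [Matrix.IsSymm]
    simp only [Matrix.transpose_mul, Matrix.transpose_transpose, (hvsym 0).eq, Matrix.mul_assoc]
  obtain ⟨U, φ, hφ, hU1, hU2, hU⟩ := exists_sorted_spectral hS
  let u : GL (Fin n) ℝ := ⟨U, Uᵀ, hU2, hU1⟩
  have hg : ((p * u : GL (Fin n) ℝ) : Matrix (Fin n) (Fin n) ℝ) = P * U := rfl
  have hvel0 : velocity X 0 = P * U * Matrix.diagonal φ * (P * U)ᵀ := by
    have : P * (P⁻¹ * velocity X 0 * P⁻¹ᵀ) * Pᵀ = velocity X 0 := by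
      simp only [Matrix.mul_assoc, hP, gl_transpose_inv_mul, Matrix.mul_one]
      rw [← Matrix.mul_assoc, gl_mul_inv, Matrix.one_mul]
    rw [← this, hU, Matrix.transpose_mul]
    simp only [Matrix.mul_assoc]
  set G : Matrix (Fin n) (Fin n) ℝ := P * U with hG
  have hX0 : X 0 = G * Gᵀ := by
    rw [hp, hG, Matrix.transpose_mul, Matrix.mul_assoc, ← Matrix.mul_assoc U, hU2, Matrix.one_mul]
  have hGi : Gᵀ * G⁻¹ᵀ = 1 := by rw [← hg]; exact gl_transpose_mul_inv _
  have hMG : M * G⁻¹ᵀ = G⁻¹ᵀ * Matrix.diagonal φ := by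
    have h1 : velocity X 0 * G⁻¹ᵀ = X 0 * (G⁻¹ᵀ * Matrix.diagonal φ) := by
      rw [hvel0, hX0]
      simp only [Matrix.mul_assoc, hGi, Matrix.mul_one]
      rw [← Matrix.mul_assoc Gᵀ, hGi, Matrix.one_mul]
    rw [hM, Matrix.mul_assoc, h1, ← Matrix.mul_assoc, e1, Matrix.one_mul]
  -- The linear equation `X' = X M` is solved with an integrating factor: `M G⁻¹ᵀ = G⁻¹ᵀ diag(φ)`,
  -- so this product is constant.
  have hconst : ∀ t, X t * G⁻¹ᵀ * Matrix.diagonal (fun i => Real.exp (-φ i * t)) = G := by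
    intro t
    have h0 : ∀ s, HasMatDeriv
        (fun s => X s * G⁻¹ᵀ * Matrix.diagonal (fun i => Real.exp (-φ i * s))) 0 s := by
      intro s
      have h := ((hd s).mul_const G⁻¹ᵀ).mul (hasMatDeriv_diagonal_exp (fun i => -φ i) s)
      convert h using 1
      have hneg : Matrix.diagonal (fun i => -φ i) = -Matrix.diagonal φ := by
        rw [Matrix.diagonal_neg]
      rw [hvel, Matrix.mul_assoc (X s), hMG, hneg]
      simp only [Matrix.neg_mul, Matrix.mul_neg, Matrix.mul_assoc, add_neg_cancel]
    have := eq_of_hasMatDeriv_zero h0 t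
    rw [this, hX0]
    simp [Matrix.mul_assoc, hGi]
  have hmain : X = expCurve (p * u) φ := by
    ext1 t
    have h1 : Matrix.diagonal (fun i => Real.exp (-φ i * t)) *
        Matrix.diagonal (fun i => Real.exp (φ i * t)) = 1 := by
      rw [Matrix.diagonal_mul_diagonal]
      simp [← Real.exp_add]
    have h2 := congrArg (· * Matrix.diagonal (fun i => Real.exp (φ i * t)) * Gᵀ) (hconst t)
    simp only [Matrix.mul_assoc] at h2
    rw [← Matrix.mul_assoc (Matrix.diagonal fun i => Real.exp (-φ i * t)), h1, Matrix.one_mul] at h2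
    have h3 : G⁻¹ᵀ * Gᵀ = 1 := by rw [← hg]; exact gl_transpose_inv_mul _
    rw [h3, Matrix.mul_one] at h2
    rw [h2, expCurve, hg, Matrix.mul_assoc G]
  refine ⟨p * u, φ, hφ, fun h0 => ?_, hmain⟩
  obtain ⟨s, t, hst⟩ := μ.nonconst
  apply hst
  rw [← hX, hmain, h0]
  simp [expCurve]

/-! ### The Riemannian distance -/

theorem quadForm_eq (X : Matrix (Fin n) (Fin n) ℝ) (v : Fin n → ℝ) :
    quadForm X v = 1 / 2 * (v ⬝ᵥ X *ᵥ v) := by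
  simp only [quadForm, dotProduct, Matrix.mulVec, Finset.mul_sum]
  refine Finset.sum_congr rfl fun i _ => Finset.sum_congr rfl fun j _ => ?_
  ring

theorem quadForm_conj (P X : Matrix (Fin n) (Fin n) ℝ) (v : Fin n → ℝ) :
    quadForm (P * X * Pᵀ) v = quadForm X (Pᵀ *ᵥ v) := by
  rw [quadForm_eq, quadForm_eq, ← Matrix.mulVec_mulVec, ← Matrix.mulVec_mulVec,
    Matrix.dotProduct_mulVec, ← Matrix.mulVec_transpose]

theorem quadForm_diagonal (d v : Fin n → ℝ) :
    quadForm (Matrix.diagonal d) v = 1 / 2 * ∑ i, d i * v i ^ 2 := by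
  rw [quadForm_eq, dotProduct]
  congr 1
  refine Finset.sum_congr rfl fun i _ => ?_
  rw [Matrix.mulVec_diagonal]
  ring

theorem quadForm_pos {X : Matrix (Fin n) (Fin n) ℝ} (hX : X.PosDef) {v : Fin n → ℝ} (hv : v ≠ 0) :
    0 < quadForm X v := by
  rw [quadForm_eq]
  have := hX.dotProduct_mulVec_pos hv
  rw [star_trivial] at this
  linarith

theorem metric_conj (g : GL (Fin n) ℝ) (X U V : Matrix (Fin n) (Fin n) ℝ) :
    metric ((g : Matrix (Fin n) (Fin n) ℝ) * X * (g : Matrix (Fin n) (Fin n) ℝ)ᵀ)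
      ((g : Matrix (Fin n) (Fin n) ℝ) * U * (g : Matrix (Fin n) (Fin n) ℝ)ᵀ)
      ((g : Matrix (Fin n) (Fin n) ℝ) * V * (g : Matrix (Fin n) (Fin n) ℝ)ᵀ) = metric X U V := by
  have ha : ∀ A : Matrix (Fin n) (Fin n) ℝ, (g : Matrix (Fin n) (Fin n) ℝ)ᵀ *
      ((g : Matrix (Fin n) (Fin n) ℝ)⁻¹ᵀ * A) = A := fun A => by
    rw [← Matrix.mul_assoc, gl_transpose_mul_inv, Matrix.one_mul]
  have hb : ∀ A : Matrix (Fin n) (Fin n) ℝ, (g : Matrix (Fin n) (Fin n) ℝ)⁻¹ *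
      ((g : Matrix (Fin n) (Fin n) ℝ) * A) = A := fun A => by
    rw [← Matrix.mul_assoc, gl_inv_mul, Matrix.one_mul]
  rw [metric, metric, Matrix.mul_inv_rev, Matrix.mul_inv_rev, ← Matrix.transpose_nonsing_inv]
  simp only [Matrix.mul_assoc, ha, hb]
  rw [Matrix.trace_mul_comm]
  simp only [Matrix.mul_assoc, gl_inv_mul, Matrix.mul_one]

theorem metric_one_self {U : Matrix (Fin n) (Fin n) ℝ} (hU : U.IsSymm) :
    metric 1 U U = ∑ i, ∑ j, U i j ^ 2 := by
  simp only [metric, inv_one, Matrix.mul_one]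
  simp only [Matrix.trace, Matrix.diag, Matrix.mul_apply]
  refine Finset.sum_congr rfl fun i _ => Finset.sum_congr rfl fun j _ => ?_
  rw [hU.apply i j, sq]

/-- Cauchy–Schwarz for the entries of `U` against those of `v vᵀ`, whose Frobenius norm is `|v|²`.
-/
theorem abs_quadForm_le_one (U : Matrix (Fin n) (Fin n) ℝ) (v : Fin n → ℝ) :
    |quadForm U v| ≤ √(∑ i, ∑ j, U i j ^ 2) * quadForm 1 v := by
  have h1 : quadForm 1 v = 1 / 2 * ∑ i, v i ^ 2 := by
    rw [← Matrix.diagonal_one, quadForm_diagonal]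
    simp
  have hcs := Finset.sum_mul_sq_le_sq_mul_sq (Finset.univ : Finset (Fin n × Fin n))
    (fun p => U p.1 p.2) (fun p => v p.1 * v p.2)
  simp only [Fintype.sum_prod_type] at hcs
  have h2 : ∑ i, ∑ j, (v i * v j) ^ 2 = (∑ i, v i ^ 2) ^ 2 := by
    rw [sq, Finset.sum_mul_sum]
    simp only [mul_pow]
  rw [h2, ← Real.sq_sqrt (show 0 ≤ ∑ i, ∑ j, U i j ^ 2 by positivity), ← mul_pow] at hcs
  have h3 := abs_le_of_sq_le_sq' hcs (by positivity)
  have h4 : quadForm U v = 1 / 2 * ∑ i, ∑ j, U i j * (v i * v j) := by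
    simp only [quadForm, mul_assoc]
  rw [h4, h1, abs_le]
  constructor <;> linarith [h3.1, h3.2]

/-- Both sides are invariant under congruence, so `X` may be moved to the identity. This
infinitesimal bound is the source of the Lipschitz property of `log Q_X(v)`. -/
theorem abs_quadForm_le {X U : Matrix (Fin n) (Fin n) ℝ} (hX : X.PosDef) (hU : U.IsSymm)
    (v : Fin n → ℝ) : |quadForm U v| ≤ √(metric X U U) * quadForm X v := by
  obtain ⟨g, hg⟩ := exists_eq_mul_transpose hX
  set G : Matrix (Fin n) (Fin n) ℝ := g.1 with hG
  set N := G⁻¹ * U * G⁻¹ᵀ with hN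
  have hUN : U = G * N * Gᵀ := by
    simp only [hN, Matrix.mul_assoc]
    rw [hG, gl_transpose_inv_mul, Matrix.mul_one, ← Matrix.mul_assoc, gl_mul_inv, Matrix.one_mul]
  have hNs : N.IsSymm := by
    rw [Matrix.IsSymm, hN]
    simp only [Matrix.transpose_mul, Matrix.transpose_transpose, hU.eq, Matrix.mul_assoc]
  have hX1 : X = G * 1 * Gᵀ := by rw [Matrix.mul_one]; exact hg
  rw [hUN, hX1, metric_conj, quadForm_conj G N, quadForm_conj G 1, metric_one_self hNs]
  exact abs_quadForm_le_one _ _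

theorem metric_expCurve (g : GL (Fin n) ℝ) (φ : Fin n → ℝ) (t : ℝ) :
    metric (expCurve g φ t) (velocity (expCurve g φ) t) (velocity (expCurve g φ) t) =
      ∑ i, φ i ^ 2 := by
  have hX : expCurve g φ t * (expCurve g φ t)⁻¹ = 1 :=
    Matrix.mul_nonsing_inv _ ((Matrix.isUnit_iff_isUnit_det _).1 (posDef_expCurve g φ t).isUnit)
  have hb : ∀ A : Matrix (Fin n) (Fin n) ℝ, (g : Matrix (Fin n) (Fin n) ℝ)⁻¹ *
      ((g : Matrix (Fin n) (Fin n) ℝ) * A) = A := fun A => by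
    rw [← Matrix.mul_assoc, gl_inv_mul, Matrix.one_mul]
  rw [(hasMatDeriv_expCurve g φ t).velocity, metric]
  rw [Matrix.mul_assoc _ (expCurve g φ t), hX, Matrix.mul_one, Matrix.mul_assoc _ (_ * _),
    Matrix.mul_assoc _ (expCurve g φ t), hX, Matrix.mul_one]
  simp only [Matrix.mul_assoc, hb]
  rw [Matrix.trace_mul_comm]
  simp only [Matrix.mul_assoc, gl_inv_mul, Matrix.mul_one, Matrix.diagonal_mul_diagonal,
    Matrix.trace_diagonal, sq]

theorem length_nonneg (c : ℝ → Matrix (Fin n) (Fin n) ℝ) : 0 ≤ length c :=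
  intervalIntegral.integral_nonneg zero_le_one fun _ _ => Real.sqrt_nonneg _

theorem rho_nonneg (X Y : Matrix (Fin n) (Fin n) ℝ) : 0 ≤ rho X Y := by
  refine Real.sInf_nonneg ?_
  rintro _ ⟨c, -, rfl⟩
  exact length_nonneg c

theorem rho_le_length {X Y : Matrix (Fin n) (Fin n) ℝ} {c : ℝ → Matrix (Fin n) (Fin n) ℝ}
    (hc : IsPath X Y c) : rho X Y ≤ length c := by
  refine csInf_le ⟨0, ?_⟩ ⟨c, hc, rfl⟩
  rintro _ ⟨c, -, rfl⟩
  exact length_nonneg c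

theorem PosDef.conj {Y : Matrix (Fin n) (Fin n) ℝ} (hY : Y.PosDef) (g : GL (Fin n) ℝ) :
    ((g : Matrix (Fin n) (Fin n) ℝ) * Y * (g : Matrix (Fin n) (Fin n) ℝ)ᵀ).PosDef := by
  have h := hY.conjTranspose_mul_mul_same (B := (g : Matrix (Fin n) (Fin n) ℝ)ᵀ)
    (gl_transpose_mulVec_injective g)
  rwa [Matrix.conjTranspose_eq_transpose_of_trivial, Matrix.transpose_transpose] at h

theorem IsPath.conj {X Y : Matrix (Fin n) (Fin n) ℝ} {c : ℝ → Matrix (Fin n) (Fin n) ℝ}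
    (hc : IsPath X Y c) (g : GL (Fin n) ℝ) :
    IsPath ((g : Matrix (Fin n) (Fin n) ℝ) * X * (g : Matrix (Fin n) (Fin n) ℝ)ᵀ)
      ((g : Matrix (Fin n) (Fin n) ℝ) * Y * (g : Matrix (Fin n) (Fin n) ℝ)ᵀ)
      (fun t => (g : Matrix (Fin n) (Fin n) ℝ) * c t * (g : Matrix (Fin n) (Fin n) ℝ)ᵀ) where
  smooth i j := by
    simp only [Matrix.mul_apply]
    have := hc.smooth
    fun_prop
  posDef t ht := PosDef.conj (hc.posDef t ht) g
  source := by simp only [hc.source]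
  target := by simp only [hc.target]

theorem IsPath.length_conj {X Y : Matrix (Fin n) (Fin n) ℝ} {c : ℝ → Matrix (Fin n) (Fin n) ℝ}
    (hc : IsPath X Y c) (g : GL (Fin n) ℝ) :
    length (fun t => (g : Matrix (Fin n) (Fin n) ℝ) * c t * (g : Matrix (Fin n) (Fin n) ℝ)ᵀ) =
      length c := by
  unfold length
  congr 1
  ext t
  have h := ((hasMatDeriv_velocity hc.smooth t).const_mul
    (g : Matrix (Fin n) (Fin n) ℝ)).mul_const (g : Matrix (Fin n) (Fin n) ℝ)ᵀ
  rw [h.velocity, metric_conj]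

theorem abs_log_le_two_mul {x : ℝ} (hx : |x - 1| ≤ 1 / 2) : |Real.log x| ≤ 2 * |x - 1| := by
  have h := abs_le.1 hx
  have hx0 : 0 < x := by linarith [h.1]
  have h1 := Real.log_le_sub_one_of_pos hx0
  have h2 := Real.one_sub_inv_le_log_of_pos hx0
  have h4 : -(2 * |x - 1|) ≤ 1 - x⁻¹ := by
    have e : 1 - x⁻¹ = (x - 1) / x := by field_simp
    rw [e, le_div_iff₀ hx0]
    nlinarith [neg_abs_le (x - 1), abs_nonneg (x - 1), h.1]
  rw [abs_le]
  constructor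
  · linarith
  · linarith [le_abs_self (x - 1), abs_nonneg (x - 1)]

/-- Two points are joined by a curve, which is short if the points are close. -/
theorem exists_isPath_one {Y : Matrix (Fin n) (Fin n) ℝ} (hY : Y.PosDef) :
    ∃ c, IsPath 1 Y c ∧ (∑ i, ∑ j, (Y - 1) i j ^ 2 ≤ 1 / 4 →
      length c ≤ 2 * √(∑ i, ∑ j, (Y - 1) i j ^ 2)) := by
  obtain ⟨U, l, -, hl, hU1, hU2, hU⟩ := exists_sorted_spectral_posDef hY
  let u : GL (Fin n) ℝ := ⟨U, Uᵀ, hU2, hU1⟩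
  have hfro : ∑ i, ∑ j, (Y - 1) i j ^ 2 = ∑ i, (l i - 1) ^ 2 := by
    have hsym : (Y - 1).IsSymm := by
      rw [Matrix.IsSymm, Matrix.transpose_sub, (PosDef.isSymm hY).eq, Matrix.transpose_one]
    have e : Y - 1 = U * Matrix.diagonal (fun i => l i - 1) * Uᵀ := by
      have : Matrix.diagonal (fun i => l i - 1) = Matrix.diagonal l - 1 := by
        rw [← Matrix.diagonal_one, Matrix.diagonal_sub]
      rw [this, Matrix.mul_sub, Matrix.sub_mul, Matrix.mul_one, hU2, hU]
    have h1 : (1 : Matrix (Fin n) (Fin n) ℝ) = (u : Matrix (Fin n) (Fin n) ℝ) * 1 *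
        (u : Matrix (Fin n) (Fin n) ℝ)ᵀ := by
      rw [Matrix.mul_one]; exact hU2.symm
    have h2 := metric_conj u 1 (Matrix.diagonal fun i => l i - 1) (Matrix.diagonal fun i => l i - 1)
    rw [← h1] at h2
    rw [← metric_one_self hsym, e]
    refine h2.trans ?_
    simp [metric, sq]
  -- The connecting path is the geodesic from the identity with speeds `log l_i`. Its length is `√(∑
  -- (log l_i)²)`, which `|log x| ≤ 2|x - 1|` compares with the Frobenius norm of `Y - 1`.
  refine ⟨expCurve u fun i => Real.log (l i),
    ⟨contDiff_expCurve _ _, fun t _ => posDef_expCurve _ _ t, ?_, ?_⟩, fun hle => ?_⟩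
  · rw [expCurve_zero]; exact hU2
  · rw [hU, expCurve]
    simp only [mul_one, Real.exp_log (hl _)]
    rfl
  · rw [hfro] at hle ⊢
    have hlen : length (expCurve u fun i => Real.log (l i)) = √(∑ i, Real.log (l i) ^ 2) := by
      unfold length
      simp only [metric_expCurve]
      simp
    rw [hlen]
    have h2 : (2 : ℝ) * √(∑ i, (l i - 1) ^ 2) = √(∑ i, (2 * |l i - 1|) ^ 2) := by
      simp only [mul_pow, ← Finset.mul_sum, sq_abs]
      rw [Real.sqrt_mul (by norm_num), show (2 : ℝ) ^ 2 = 2 * 2 by norm_num,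
        Real.sqrt_mul_self (by norm_num)]
    rw [h2]
    refine Real.sqrt_le_sqrt (Finset.sum_le_sum fun i _ => ?_)
    have hi : (l i - 1) ^ 2 ≤ 1 / 4 :=
      (Finset.single_le_sum (f := fun i => (l i - 1) ^ 2) (fun _ _ => sq_nonneg _)
        (Finset.mem_univ i)).trans hle
    have := abs_log_le_two_mul (x := l i) (abs_le_of_sq_le_sq (by norm_num; linarith) (by norm_num))
    rw [← sq_abs (Real.log _)]
    gcongr

/-- Makes the set of lengths in `rho` nonempty, so that lower bounds for lengths pass to the
infimum. -/
theorem exists_isPath {X Y : Matrix (Fin n) (Fin n) ℝ} (hX : X.PosDef) (hY : Y.PosDef) :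
    ∃ c, IsPath X Y c := by
  obtain ⟨g, hg⟩ := exists_eq_mul_transpose hX
  obtain ⟨c, hc, -⟩ := exists_isPath_one (PosDef.conj hY g⁻¹)
  have h := hc.conj g
  refine ⟨fun t => (g : Matrix (Fin n) (Fin n) ℝ) * c t * (g : Matrix (Fin n) (Fin n) ℝ)ᵀ, ?_⟩
  · convert h using 1
    · rw [Matrix.mul_one, hg]
    · have e : ((g⁻¹ : GL (Fin n) ℝ) : Matrix (Fin n) (Fin n) ℝ) = (g : Matrix (Fin n) (Fin n) ℝ)⁻¹ :=
        Matrix.coe_units_inv g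
      rw [e]
      simp only [Matrix.mul_assoc]
      rw [gl_transpose_inv_mul, Matrix.mul_one, ← Matrix.mul_assoc, gl_mul_inv, Matrix.one_mul]

theorem rho_conj_le {X Y : Matrix (Fin n) (Fin n) ℝ} (hX : X.PosDef) (hY : Y.PosDef)
    (g : GL (Fin n) ℝ) :
    rho ((g : Matrix (Fin n) (Fin n) ℝ) * X * (g : Matrix (Fin n) (Fin n) ℝ)ᵀ)
      ((g : Matrix (Fin n) (Fin n) ℝ) * Y * (g : Matrix (Fin n) (Fin n) ℝ)ᵀ) ≤ rho X Y := by
  obtain ⟨c, hc⟩ := exists_isPath hX hY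
  refine le_csInf ⟨_, c, hc, rfl⟩ ?_
  rintro _ ⟨d, hd, rfl⟩
  rw [← hd.length_conj g]
  exact rho_le_length (hd.conj g)

/-- No formula for the distance is needed: an explicit short path bounds it from above. -/
theorem tendsto_rho_one {α : Type*} {l : Filter α} {Y : α → Matrix (Fin n) (Fin n) ℝ}
    (hY : ∀ a, (Y a).PosDef) (h : Tendsto Y l (𝓝 1)) : Tendsto (fun a => rho 1 (Y a)) l (𝓝 0) := by
  have h1 : Tendsto (fun a => ∑ i, ∑ j, (Y a - 1) i j ^ 2) l (𝓝 0) := by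
    have : Tendsto (fun a => ∑ i, ∑ j, (Y a - 1) i j ^ 2) l
        (𝓝 (∑ i : Fin n, ∑ j : Fin n, ((1 - 1 : Matrix (Fin n) (Fin n) ℝ) i j) ^ 2)) :=
      tendsto_finsetSum _ fun i _ => tendsto_finsetSum _ fun j _ =>
        (tendsto_matrix_iff.1 (h.sub_const 1) i j).pow 2
    simpa using this
  have h2 : Tendsto (fun a => 2 * √(∑ i, ∑ j, (Y a - 1) i j ^ 2)) l (𝓝 0) := by
    simpa using (h1.sqrt).const_mul 2
  refine squeeze_zero' (Eventually.of_forall fun a => rho_nonneg _ _) ?_ h2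
  filter_upwards [h1.eventually_le_const (show (0 : ℝ) < 1 / 4 by norm_num)] with a ha
  obtain ⟨c, hc, hl⟩ := exists_isPath_one (hY a)
  exact (rho_le_length hc).trans (hl ha)

/-! ### Lower bound for the distance by logarithms of quadratic forms -/

theorem HasMatDeriv.quadForm {X : ℝ → Matrix (Fin n) (Fin n) ℝ} {X' : Matrix (Fin n) (Fin n) ℝ}
    {t : ℝ} (hX : HasMatDeriv X X' t) (v : Fin n → ℝ) :
    HasDerivAt (fun s => quadForm (X s) v) (quadForm X' v) t :=
  (HasDerivAt.fun_sum fun i _ => HasDerivAt.fun_sum fun j _ =>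
    ((hX i j).mul_const (v i)).mul_const (v j)).const_mul _

theorem IsPath.continuousOn_speed {X Y : Matrix (Fin n) (Fin n) ℝ}
    {c : ℝ → Matrix (Fin n) (Fin n) ℝ} (hc : IsPath X Y c) :
    ContinuousOn (fun t => √(metric (c t) (velocity c t) (velocity c t))) (Set.Icc 0 1) := by
  have hv : Continuous (velocity c) := continuous_matrix fun i j =>
    (hc.smooth i j).continuous_deriv_one
  have hcc : Continuous c := continuous_matrix fun i j => (hc.smooth i j).continuous
  have hi : ContinuousOn (fun t => (c t)⁻¹) (Set.Icc 0 1) := fun t ht =>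
    tendsto_inv (hc.posDef t ht).isUnit (hcc.tendsto t |>.mono_left nhdsWithin_le_nhds)
  refine ContinuousOn.sqrt ?_
  exact continuous_id.matrix_trace.comp_continuousOn
    (((hv.continuousOn.mul hi).mul hv.continuousOn).mul hi)

/-- The logarithmic derivative `Q_{c'}(v) / Q_c(v)` is bounded in absolute value by the speed of
`c`; integrate over `[0, 1]`. -/
theorem IsPath.log_quadForm_sub_le {X Y : Matrix (Fin n) (Fin n) ℝ}
    {c : ℝ → Matrix (Fin n) (Fin n) ℝ} (hc : IsPath X Y c) {v : Fin n → ℝ} (hv : v ≠ 0) :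
    |Real.log (quadForm Y v) - Real.log (quadForm X v)| ≤ length c := by
  have hd : ∀ t, HasMatDeriv c (velocity c t) t := hasMatDeriv_velocity hc.smooth
  have hsp := hc.continuousOn_speed
  have hpos : ∀ t ∈ Set.Icc (0 : ℝ) 1, 0 < quadForm (c t) v := fun t ht =>
    quadForm_pos (hc.posDef t ht) hv
  have hlog : ∀ t ∈ Set.Icc (0 : ℝ) 1, HasDerivAt (fun s => Real.log (quadForm (c s) v))
      (quadForm (velocity c t) v / quadForm (c t) v) t := fun t ht =>
    ((hd t).quadForm v).log (hpos t ht).ne'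
  have hbd : ∀ t ∈ Set.Ioo (0 : ℝ) 1, |quadForm (velocity c t) v / quadForm (c t) v| ≤
      √(metric (c t) (velocity c t) (velocity c t)) := by
    intro t ht
    -- Positive definiteness is known only on `[0, 1]`, so symmetry of nearby values requires an
    -- interior `t`.
    have hs : (velocity c t).IsSymm := (hd t).isSymm <| by
      filter_upwards [Ioo_mem_nhds ht.1 ht.2] with s hs
      exact PosDef.isSymm (hc.posDef s (Set.Ioo_subset_Icc_self hs))
    rw [abs_div, abs_of_pos (hpos t (Set.Ioo_subset_Icc_self ht)),
      div_le_iff₀ (hpos t (Set.Ioo_subset_Icc_self ht))]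
    exact abs_quadForm_le (hc.posDef t (Set.Ioo_subset_Icc_self ht)) hs v
  have hcont : ContinuousOn (fun s => Real.log (quadForm (c s) v)) (Set.Icc 0 1) :=
    fun t ht => (hlog t ht).continuousAt.continuousWithinAt
  have hint : MeasureTheory.IntegrableOn
      (fun t => √(metric (c t) (velocity c t) (velocity c t))) (Set.Icc 0 1) :=
    hsp.integrableOn_Icc
  rw [abs_le]
  constructor
  · have := intervalIntegral.sub_le_integral_of_hasDeriv_right_of_le (a := 0) (b := 1) zero_le_one
      hcont.neg (fun t ht => (hlog t (Set.Ioo_subset_Icc_self ht)).neg.hasDerivWithinAt) hint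
      (fun t ht => (neg_le_abs _).trans (hbd t ht))
    simp only [Pi.neg_apply, hc.source, hc.target] at this
    change _ ≤ length c at this
    linarith
  · have := intervalIntegral.sub_le_integral_of_hasDeriv_right_of_le (a := 0) (b := 1) zero_le_one
      hcont (fun t ht => (hlog t (Set.Ioo_subset_Icc_self ht)).hasDerivWithinAt) hint
      (fun t ht => (le_abs_self _).trans (hbd t ht))
    simp only [hc.source, hc.target] at this
    exact this

/-- Close points have close quadratic forms. -/
theorem log_quadForm_sub_le_rho {X Y : Matrix (Fin n) (Fin n) ℝ} (hX : X.PosDef) (hY : Y.PosDef)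
    {v : Fin n → ℝ} (hv : v ≠ 0) :
    |Real.log (quadForm Y v) - Real.log (quadForm X v)| ≤ rho X Y := by
  obtain ⟨c, hc⟩ := exists_isPath hX hY
  refine le_csInf ⟨_, c, hc, rfl⟩ ?_
  rintro _ ⟨d, hd, rfl⟩
  exact hd.log_quadForm_sub_le hv

theorem rho_self {X : Matrix (Fin n) (Fin n) ℝ} (hX : X.PosDef) : rho X X = 0 := by
  refine le_antisymm ?_ (rho_nonneg _ _)
  have hc : IsPath X X fun _ => X :=
    ⟨fun _ _ => contDiff_const, fun _ _ => hX, rfl, rfl⟩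
  refine (rho_le_length hc).trans (le_of_eq ?_)
  have hv : ∀ t, velocity (fun _ : ℝ => X) t = 0 := fun t => (hasMatDeriv_const X t).velocity
  simp [length, hv, metric]

/-! ### Null asymptotic geodesics -/

theorem distForward_nonneg (X : Matrix (Fin n) (Fin n) ℝ) (ν : ParamGeodesic n) (S : ℝ) :
    0 ≤ distForward X ν S := by
  refine Real.sInf_nonneg ?_
  rintro _ ⟨s, -, rfl⟩
  exact rho_nonneg _ _

theorem distForward_le (X : Matrix (Fin n) (Fin n) ℝ) (ν : ParamGeodesic n) {S s : ℝ}
    (hs : S ≤ s) : distForward X ν S ≤ rho X (ν.toFun s) := by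
  refine csInf_le ⟨0, ?_⟩ ⟨s, hs, rfl⟩
  rintro _ ⟨s, -, rfl⟩
  exact rho_nonneg _ _

theorem nullAsymptotic_of_tendsto {μ ν : ParamGeodesic n} {s : ℝ → ℝ} (hs : Tendsto s atTop atTop)
    (h : Tendsto (fun t => rho (μ.toFun t) (ν.toFun (s t))) atTop (𝓝 0)) : NullAsymptotic μ ν := by
  intro S
  refine squeeze_zero' (Eventually.of_forall fun t => distForward_nonneg _ _ _) ?_ h
  filter_upwards [hs.eventually_ge_atTop S] with t ht
  exact distForward_le _ _ ht

/-- Taking `S = N` and a time at which the infimum is below `1 / (N + 1)` forces both sequences of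
times to infinity. Sequences are all that the comparison of data needs. -/
theorem NullAsymptotic.exists_seq {μ ν : ParamGeodesic n} (h : NullAsymptotic μ ν) :
    ∃ t s : ℕ → ℝ, Tendsto t atTop atTop ∧ Tendsto s atTop atTop ∧
      Tendsto (fun N => rho (μ.toFun (t N)) (ν.toFun (s N))) atTop (𝓝 0) := by
  have key : ∀ N : ℕ, ∃ t s : ℝ, (N : ℝ) ≤ t ∧ (N : ℝ) ≤ s ∧
      rho (μ.toFun t) (ν.toFun s) < 1 / ((N : ℝ) + 1) := by
    intro N
    have h1 := (h N).eventually_lt_const (show (0 : ℝ) < 1 / ((N : ℝ) + 1) by positivity)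
    obtain ⟨t, ht, htN⟩ := (h1.and (eventually_ge_atTop (N : ℝ))).exists
    obtain ⟨_, ⟨s, hs, rfl⟩, hlt⟩ := exists_lt_of_csInf_lt (s := {d | ∃ s, (N : ℝ) ≤ s ∧
      d = rho (μ.toFun t) (ν.toFun s)}) ⟨_, (N : ℝ), le_rfl, rfl⟩ ht
    exact ⟨t, s, htN, hs, hlt⟩
  choose t s ht hs hts using key
  refine ⟨t, s, tendsto_atTop_mono ht tendsto_natCast_atTop_atTop,
    tendsto_atTop_mono hs tendsto_natCast_atTop_atTop, ?_⟩
  exact squeeze_zero (fun N => rho_nonneg _ _) (fun N => (hts N).le)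
    tendsto_one_div_add_atTop_nhds_zero_nat

/-! ### Blocks -/

theorem cut_strictMono (I : CompositionAsSet n) : StrictMono (cut I) :=
  (I.boundaries.orderEmbOfFin I.card_boundaries_eq_succ_length).strictMono

theorem cut_lt_cut_iff (I : CompositionAsSet n) {k l : Fin (I.length + 1)} :
    (cut I k : ℕ) < cut I l ↔ k < l :=
  Fin.val_fin_lt.trans (cut_strictMono I).lt_iff_lt

theorem cut_le_cut_iff (I : CompositionAsSet n) {k l : Fin (I.length + 1)} :
    (cut I k : ℕ) ≤ cut I l ↔ k ≤ l :=
  Fin.val_fin_le.trans (cut_strictMono I).le_iff_le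

theorem mem_boundaries_iff (I : CompositionAsSet n) (j : Fin (n + 1)) :
    j ∈ I.boundaries ↔ ∃ k, cut I k = j := by
  rw [← Finset.mem_coe, ← Finset.range_orderEmbOfFin I.boundaries I.card_boundaries_eq_succ_length]
  rfl

theorem cut_zero (I : CompositionAsSet n) : cut I 0 = 0 := by
  obtain ⟨k, hk⟩ := (mem_boundaries_iff I 0).1 I.zero_mem
  exact le_antisymm (hk ▸ (cut_strictMono I).monotone (Fin.zero_le k)) (Fin.zero_le _)

theorem cut_last (I : CompositionAsSet n) : cut I (Fin.last _) = Fin.last n := by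
  obtain ⟨k, hk⟩ := (mem_boundaries_iff I _).1 I.getLast_mem
  exact le_antisymm (Fin.le_last _) (hk ▸ (cut_strictMono I).monotone (Fin.le_last k))

/-- In a chain indexed by `0, …, m`, a property of initial segments that holds at `0` and fails
at `m` switches at a unique place. -/
theorem exists_switch {m : ℕ} {p : Fin (m + 1) → Prop} (h0 : p 0) (hm : ¬ p (Fin.last m)) :
    ∃ k : Fin m, p k.castSucc ∧ ¬ p k.succ := by
  by_contra! h
  have : ∀ k : Fin (m + 1), p k := fun k => Fin.induction h0 (fun k hk => h k hk) k
  exact hm (this _)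

theorem exists_block (I : CompositionAsSet n) (i : Fin n) :
    ∃ k : Fin I.length, (cut I k.castSucc : ℕ) ≤ i ∧ (i : ℕ) < cut I k.succ := by
  obtain ⟨k, h1, h2⟩ := exists_switch (p := fun k => (cut I k : ℕ) ≤ i)
    (by simp [cut_zero]) (by simp [cut_last])
  exact ⟨k, h1, not_le.1 h2⟩

/-- The block containing a position. -/
def blk (I : CompositionAsSet n) (i : Fin n) : Fin I.length := (exists_block I i).choose

theorem cut_blk_le (I : CompositionAsSet n) (i : Fin n) : (cut I (blk I i).castSucc : ℕ) ≤ i :=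
  (exists_block I i).choose_spec.1

theorem lt_cut_blk (I : CompositionAsSet n) (i : Fin n) : (i : ℕ) < cut I (blk I i).succ :=
  (exists_block I i).choose_spec.2

theorem lt_cut_iff (I : CompositionAsSet n) (i : Fin n) (k : Fin (I.length + 1)) :
    (i : ℕ) < cut I k ↔ (blk I i).castSucc < k := by
  constructor
  · intro h
    exact (cut_lt_cut_iff I).1 ((cut_blk_le I i).trans_lt h)
  · intro h
    exact (lt_cut_blk I i).trans_le ((cut_le_cut_iff I).2 (Fin.castSucc_lt_iff_succ_le.1 h))

theorem blk_eq_iff (I : CompositionAsSet n) (i : Fin n) (k : Fin I.length) :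
    blk I i = k ↔ (cut I k.castSucc : ℕ) ≤ i ∧ (i : ℕ) < cut I k.succ := by
  rw [← not_lt, lt_cut_iff, lt_cut_iff, Fin.castSucc_lt_castSucc_iff, Fin.castSucc_lt_succ_iff,
    not_lt, and_comm]
  exact le_antisymm_iff

theorem blk_mono (I : CompositionAsSet n) : Monotone (blk I) := by
  intro i j hij
  by_contra! h
  have h1 := (lt_cut_iff I j (blk I i).castSucc).2 (Fin.castSucc_lt_castSucc_iff.2 h)
  have h2 := cut_blk_le I i
  have h3 : (i : ℕ) ≤ j := hij
  omega

theorem card_blk_lt (I : CompositionAsSet n) (k : Fin (I.length + 1)) :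
    (Finset.univ.filter fun i : Fin n => (blk I i).castSucc < k).card = cut I k := by
  simp only [← lt_cut_iff]
  rw [Fin.card_filter_val_lt]
  exact min_eq_right (Fin.is_le _)

theorem card_blk_eq (I : CompositionAsSet n) (k : Fin I.length) :
    (Finset.univ.filter fun i : Fin n => blk I i = k).card + (cut I k.castSucc : ℕ) =
      cut I k.succ := by
  rw [← card_blk_lt, ← card_blk_lt, add_comm, ← Finset.card_union_of_disjoint]
  · congr 1
    ext i
    simp only [Finset.mem_union, Finset.mem_filter, Finset.mem_univ, true_and,
      Fin.castSucc_lt_castSucc_iff, Fin.castSucc_lt_succ_iff]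
    exact le_iff_lt_or_eq.symm
  · rw [Finset.disjoint_filter]
    rintro i - h rfl
    exact lt_irrefl _ h

theorem exists_blk_eq (I : CompositionAsSet n) (k : Fin I.length) : ∃ i, blk I i = k := by
  have h := card_blk_eq I k
  have h1 := (cut_lt_cut_iff I).2 (Fin.castSucc_lt_succ (i := k))
  obtain ⟨i, hi⟩ := Finset.card_pos.1 (show 0 < (Finset.univ.filter fun i => blk I i = k).card by omega)
  exact ⟨i, by simpa using hi⟩

theorem hasVelocity_iff (μ : ParamGeodesic n) (I : CompositionAsSet n) (ψ : Speeds I) :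
    HasVelocity μ I ψ ↔ ∃ g : GL (Fin n) ℝ, μ.toFun = expCurve g fun i => ψ.1 (blk I i) := by
  constructor
  · rintro ⟨φ, hφ, g, hg⟩
    have : φ = fun i => ψ.1 (blk I i) :=
      funext fun i => hφ _ i (cut_blk_le I i) (lt_cut_blk I i)
    exact ⟨g, by rw [← this]; exact funext hg⟩
  · rintro ⟨g, hg⟩
    refine ⟨fun i => ψ.1 (blk I i), fun k i h1 h2 => ?_, g, fun t => congrFun hg t⟩
    exact congrArg ψ.1 ((blk_eq_iff I i k).2 ⟨h1, h2⟩)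

/-- A nonzero decreasing sequence is given by strictly decreasing values on blocks. -/
theorem exists_speeds {φ : Fin n → ℝ} (hφ : Antitone φ) (h0 : φ ≠ 0) :
    ∃ (I : CompositionAsSet n) (ψ : Speeds I), φ = fun i => ψ.1 (blk I i) := by
  classical
  -- A cut is a position across which `φ` strictly drops; at `0` and `n` the condition is vacuous.
  let I : CompositionAsSet n :=
    { boundaries := Finset.univ.filter fun j : Fin (n + 1) =>
        ∀ i i' : Fin n, (i : ℕ) < j → (j : ℕ) ≤ i' → φ i' < φ i
      zero_mem := by simp
      getLast_mem := by
        simp only [Finset.mem_filter, Finset.mem_univ, true_and, Fin.val_last]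
        intro i i' _ h
        exact absurd i'.2 (not_lt.2 h) }
  have hb : ∀ i i' : Fin n, blk I i < blk I i' → φ i' < φ i := by
    intro i i' h
    have hm := (mem_boundaries_iff I (cut I (blk I i').castSucc)).2 ⟨_, rfl⟩
    simp only [I, Finset.mem_filter, Finset.mem_univ, true_and] at hm
    refine hm i i' ?_ (cut_blk_le I i')
    exact (lt_cut_iff I i _).2 (Fin.castSucc_lt_castSucc_iff.2 h)
  have hc' : ∀ i i' : Fin n, i ≤ i' → φ i' < φ i → blk I i ≠ blk I i' := by
    intro i i' hii hlt heq
    have hne : (Finset.univ.filter fun j : Fin n => φ j < φ i).Nonempty := ⟨i', by simpa using hlt⟩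
    -- The first index with value below `φ i` is a cut, and it separates `i` from `i'`.
    set j := Finset.min' _ hne with hj
    have hjm : φ j < φ i := by simpa using Finset.min'_mem _ hne
    have hjmin : ∀ l, φ l < φ i → j ≤ l := fun l hl => Finset.min'_le _ _ (by simpa using hl)
    have hij : i < j := by
      by_contra! h
      exact absurd (hφ h) (not_le.2 hjm)
    have hmem : (j.castSucc : Fin (n + 1)) ∈ I.boundaries := by
      simp only [I, Finset.mem_filter, Finset.mem_univ, true_and, Fin.val_castSucc]
      intro a b ha hb
      have h1 : φ i ≤ φ a := by
        by_contra! h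
        exact absurd (hjmin a h) (not_le.2 ha)
      exact (hφ (show j ≤ b from hb)).trans_lt (hjm.trans_le h1)
    obtain ⟨k, hk⟩ := (mem_boundaries_iff I _).1 hmem
    have hkv : (cut I k : ℕ) = j := by rw [hk]; rfl
    have h1 : (blk I i).castSucc < k := (lt_cut_iff I i k).1 (by rw [hkv]; exact hij)
    have h2 : ¬ (blk I i').castSucc < k := by
      rw [← lt_cut_iff, hkv, not_lt]
      exact hjmin i' hlt
    exact h2 (heq ▸ h1)
  have hc : ∀ i i' : Fin n, blk I i = blk I i' → φ i = φ i' := by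
    intro i i' h
    rcases le_total i i' with hii | hii
    · exact le_antisymm (not_lt.1 fun hlt => hc' _ _ hii hlt h) (hφ hii)
    · exact le_antisymm (hφ hii) (not_lt.1 fun hlt => hc' _ _ hii hlt h.symm)
  choose r hr using exists_blk_eq I
  have hφr : ∀ i, φ i = φ (r (blk I i)) := fun i => hc _ _ (hr _).symm
  refine ⟨I, ⟨fun k => φ (r k), fun k l hkl => hb _ _ (by rwa [hr, hr]), fun h => ?_⟩, funext hφr⟩
  exact h0 (funext fun i => (hφr i).trans (congrFun h _))

/-! ### Subspaces cut out by coordinates -/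

/-- The vectors whose coordinates in `p` with respect to the rows of `A` vanish. -/
def coordKer (A : Matrix (Fin n) (Fin n) ℝ) (p : Fin n → Prop) : Submodule ℝ (Fin n → ℝ) where
  carrier := {v | ∀ i, p i → (A *ᵥ v) i = 0}
  add_mem' := by
    intro v w hv hw i hi
    rw [Matrix.mulVec_add, Pi.add_apply, hv i hi, hw i hi, add_zero]
  zero_mem' := by
    intro i _
    rw [Matrix.mulVec_zero, Pi.zero_apply]
  smul_mem' := by
    intro c v hv i hi
    rw [Matrix.mulVec_smul, Pi.smul_apply, hv i hi, smul_zero]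

theorem mem_coordKer {A : Matrix (Fin n) (Fin n) ℝ} {p : Fin n → Prop} {v : Fin n → ℝ} :
    v ∈ coordKer A p ↔ ∀ i, p i → (A *ᵥ v) i = 0 := Iff.rfl

theorem finrank_coordKer {A : Matrix (Fin n) (Fin n) ℝ} (hA : IsUnit A) (p : Fin n → Prop)
    [DecidablePred p] :
    Module.finrank ℝ (coordKer A p) + (Finset.univ.filter p).card = n := by
  let f : (Fin n → ℝ) →ₗ[ℝ] ({i // p i} → ℝ) :=
    (LinearMap.funLeft ℝ ℝ (Subtype.val : {i // p i} → Fin n)).comp A.mulVecLin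
  have hker : f.ker = coordKer A p := by
    ext v
    rw [LinearMap.mem_ker, mem_coordKer, funext_iff]
    exact ⟨fun h i hi => h ⟨i, hi⟩, fun h i => h i.1 i.2⟩
  have hsurj : Function.Surjective f := by
    rw [LinearMap.coe_comp]
    refine (LinearMap.funLeft_surjective_of_injective ℝ ℝ _ Subtype.val_injective).comp ?_
    exact Matrix.mulVec_surjective_iff_isUnit.2 hA
  have h := LinearMap.finrank_range_add_finrank_ker f
  rw [LinearMap.range_eq_top.2 hsurj, hker, finrank_top, Module.finrank_fintype_fun_eq_card,
    Module.finrank_fintype_fun_eq_card, Fintype.card_fin, Fintype.card_subtype] at h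
  rw [add_comm]
  exact h

/-- If fewer than `n` conditions are imposed there is a nonzero solution. -/
theorem exists_ne_zero_of_card_lt (A B : Matrix (Fin n) (Fin n) ℝ) (p q : Fin n → Prop)
    [DecidablePred p] [DecidablePred q] (hA : IsUnit A) (hB : IsUnit B)
    (h : (Finset.univ.filter p).card + (Finset.univ.filter q).card < n) :
    ∃ v : Fin n → ℝ, v ≠ 0 ∧ (∀ i, p i → (A *ᵥ v) i = 0) ∧ ∀ i, q i → (B *ᵥ v) i = 0 := by
  have h1 := finrank_coordKer hA p
  have h2 := finrank_coordKer hB q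
  have h3 := Submodule.finrank_sup_add_finrank_inf_eq (coordKer A p) (coordKer B q)
  have h4 := Submodule.finrank_le (coordKer A p ⊔ coordKer B q)
  rw [Module.finrank_fintype_fun_eq_card, Fintype.card_fin] at h4
  have h5 : 0 < Module.finrank ℝ ↥(coordKer A p ⊓ coordKer B q) := by omega
  obtain ⟨⟨v, hv⟩, hne⟩ := Module.finrank_pos_iff_exists_ne_zero.1 h5
  exact ⟨v, fun h => hne (Subtype.ext h), hv.1, hv.2⟩

/-! ### Frames of flags with forms -/

/-- The rows of `gᵀ` are coordinates adapted to the flag `W` and orthonormal, up to the factor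
`1 / 2`, for the forms `R`. -/
structure IsFrame {I : CompositionAsSet n} (g : GL (Fin n) ℝ) (W : Flag I) (R : Forms W) : Prop where
  mem_iff : ∀ k v, v ∈ W.1 k ↔
    ∀ i, (blk I i).castSucc < k → ((g : Matrix (Fin n) (Fin n) ℝ)ᵀ *ᵥ v) i = 0
  form_eq : ∀ (k : Fin I.length) (v : W.1 k.castSucc), (R k).1 (Submodule.Quotient.mk v) =
    1 / 2 * ∑ i, if blk I i = k then ((g : Matrix (Fin n) (Fin n) ℝ)ᵀ *ᵥ (v : Fin n → ℝ)) i ^ 2 else 0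

theorem isUnit_transpose (g : GL (Fin n) ℝ) : IsUnit (g : Matrix (Fin n) (Fin n) ℝ)ᵀ :=
  ⟨⟨_, _, gl_transpose_mul_inv g, gl_transpose_inv_mul g⟩, rfl⟩

theorem Flag.mk_eq_zero_iff {I : CompositionAsSet n} (W : Flag I) {k : Fin I.length}
    (v : W.1 k.castSucc) :
    (Submodule.Quotient.mk v : W.Subquot k) = 0 ↔ (v : Fin n → ℝ) ∈ W.1 k.succ :=
  (Submodule.Quotient.mk_eq_zero _).trans Iff.rfl

theorem Flag.zero_eq_top {I : CompositionAsSet n} (W : Flag I) : W.1 0 = ⊤ := by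
  have h := W.2.2 0
  rw [cut_zero] at h
  refine Submodule.eq_top_of_finrank_eq ?_
  simpa using h

theorem Flag.last_eq_bot {I : CompositionAsSet n} (W : Flag I) : W.1 (Fin.last _) = ⊥ := by
  have h := W.2.2 (Fin.last _)
  rw [cut_last] at h
  refine Submodule.finrank_eq_zero.1 ?_
  simpa using h

theorem Flag.finrank_subquot {I : CompositionAsSet n} (W : Flag I) (k : Fin I.length) :
    Module.finrank ℝ (W.Subquot k) + cut I k.castSucc = cut I k.succ := by
  have hle : W.1 k.succ ≤ W.1 k.castSucc := W.2.1 Fin.castSucc_lt_succ.le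
  have h := Submodule.finrank_quotient_add_finrank ((W.1 k.succ).submoduleOf (W.1 k.castSucc))
  rw [LinearEquiv.finrank_eq (Submodule.submoduleOfEquivOfLe hle)] at h
  have h1 := W.2.2 k.castSucc
  have h2 := W.2.2 k.succ
  change Module.finrank ℝ (W.Subquot k) + _ = _ at h
  omega

theorem exists_flag (I : CompositionAsSet n) (g : GL (Fin n) ℝ) : ∃ W : Flag I, ∀ k v, v ∈ W.1 k ↔
    ∀ i, (blk I i).castSucc < k → ((g : Matrix (Fin n) (Fin n) ℝ)ᵀ *ᵥ v) i = 0 := by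
  refine ⟨⟨fun k => coordKer (g : Matrix (Fin n) (Fin n) ℝ)ᵀ fun i => (blk I i).castSucc < k,
    fun k l hkl v hv i hi => hv i (hi.trans_le hkl), fun k => ?_⟩, fun k v => Iff.rfl⟩
  rw [← card_blk_lt]
  exact finrank_coordKer (isUnit_transpose g) _

/-- Every invertible matrix is a frame. -/
theorem exists_isFrame (I : CompositionAsSet n) (g : GL (Fin n) ℝ) :
    ∃ (W : Flag I) (R : Forms W), IsFrame g W R := by
  obtain ⟨W, hW⟩ := exists_flag I g
  let x (k : Fin I.length) (i : Fin n) : W.1 k.castSucc →ₗ[ℝ] ℝ :=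
    (LinearMap.proj i).comp ((g : Matrix (Fin n) (Fin n) ℝ)ᵀ.mulVecLin.comp (W.1 k.castSucc).subtype)
  have hx : ∀ (k : Fin I.length) (i : Fin n), blk I i = k →
      (W.1 k.succ).submoduleOf (W.1 k.castSucc) ≤ (x k i).ker := by
    intro k i hi v hv
    refine (hW k.succ v).1 hv i ?_
    rw [hi]
    exact Fin.castSucc_lt_succ
  -- The `i`-th coordinate is used on the `k`-th subquotient only if `i` lies in block `k`, where it
  -- descends; the value `0` removes the other summands from the form.
  let l (k : Fin I.length) (i : Fin n) : W.Subquot k →ₗ[ℝ] ℝ :=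
    if h : blk I i = k then Submodule.liftQ _ (x k i) (hx k i h) else 0
  let Q (k : Fin I.length) : QuadraticForm ℝ (W.Subquot k) :=
    (1 / 2 : ℝ) • ∑ i, QuadraticMap.linMulLin (l k i) (l k i)
  have hQ : ∀ (k : Fin I.length) (v : W.1 k.castSucc), Q k (Submodule.Quotient.mk v) =
      1 / 2 * ∑ i, if blk I i = k then
        ((g : Matrix (Fin n) (Fin n) ℝ)ᵀ *ᵥ (v : Fin n → ℝ)) i ^ 2 else 0 := by
    intro k v
    simp only [Q, _root_.smul_apply, _root_.sum_apply, QuadraticMap.linMulLin_apply,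
      smul_eq_mul]
    congr 1
    refine Finset.sum_congr rfl fun i _ => ?_
    by_cases h : blk I i = k
    · simp only [l, dif_pos h, if_pos h, sq]
      rfl
    · simp [l, h]
  refine ⟨W, fun k => ⟨Q k, fun y hy => ?_⟩, hW, hQ⟩
  obtain ⟨v, rfl⟩ := Submodule.Quotient.mk_surjective _ y
  rw [hQ]
  have hv : (v : Fin n → ℝ) ∉ W.1 k.succ := fun h => hy ((W.mk_eq_zero_iff v).2 h)
  rw [hW] at hv
  push Not at hv
  obtain ⟨i, hi, hne⟩ := hv
  -- Coordinates of earlier blocks vanish on `W_k`, so a coordinate that keeps `v` out of `W_{k+1}`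
  -- belongs to block `k`.
  have hik : blk I i = k := by
    refine le_antisymm (Fin.castSucc_lt_succ_iff.1 hi) (not_lt.1 fun hlt => hne ?_)
    exact (hW k.castSucc v).1 v.2 i (Fin.castSucc_lt_castSucc_iff.2 hlt)
  refine mul_pos (by norm_num) (Finset.sum_pos' (fun j _ => ?_) ⟨i, Finset.mem_univ _, ?_⟩)
  · split_ifs <;> positivity
  · rw [if_pos hik]
    positivity

/-- Diagonalize `Q` with weights `w_i > 0` and divide the basis vectors by `√(2 w_i)`. The factor `1
/ 2` follows the normalization of `quadForm`, and the free index type will be the positions of a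
block. -/
theorem exists_orthonormal_family {V : Type*} [AddCommGroup V] [Module ℝ V] [FiniteDimensional ℝ V]
    {Q : QuadraticForm ℝ V} (hQ : Q.PosDef) {ι : Type*} [Fintype ι]
    (hι : Fintype.card ι = Module.finrank ℝ V) :
    ∃ b : ι → V, ∀ c : ι → ℝ, Q (∑ i, c i • b i) = 1 / 2 * ∑ i, c i ^ 2 := by
  classical
  obtain ⟨w, ⟨e⟩⟩ := QuadraticForm.equivalent_weightedSumSquares Q
  have hw : ∀ i, 0 < w i := by
    intro i
    have h1 : Q (e.symm (Pi.single i 1)) = w i := by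
      rw [e.symm.map_app, QuadraticMap.weightedSumSquares_apply]
      rw [Finset.sum_eq_single i]
      · simp
      · intro j _ hj
        simp [hj]
      · simp
    rw [← h1]
    refine hQ _ fun h => ?_
    have h2 := (e.symm.toLinearEquiv.map_eq_zero_iff).1 h
    simpa using congrFun h2 i
  have eι : ι ≃ Fin (Module.finrank ℝ V) := Fintype.equivOfCardEq (by simp [hι])
  refine ⟨fun i => (1 / √(2 * w (eι i))) • e.symm (Pi.single (eι i) 1), fun c => ?_⟩
  have h3 : ∑ i, c i • (1 / √(2 * w (eι i))) • e.symm (Pi.single (eι i) 1) =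
      e.symm (fun j => c (eι.symm j) / √(2 * w j)) := by
    have h4 : (fun j => c (eι.symm j) / √(2 * w j)) =
        ∑ i, (c i * (1 / √(2 * w (eι i)))) • (Pi.single (eι i) (1 : ℝ) : _ → ℝ) := by
      ext j
      rw [Finset.sum_apply, Finset.sum_eq_single (eι.symm j)]
      · simp [div_eq_mul_inv]
      · intro i _ hi
        have : j ≠ eι i := fun h => hi (by rw [h]; simp)
        simp [this]
      · simp
    rw [h4]
    change _ = e.symm.toLinearEquiv _
    rw [map_sum]
    refine Finset.sum_congr rfl fun i _ => ?_
    rw [map_smul, smul_smul]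
    rfl
  rw [h3, e.symm.map_app, QuadraticMap.weightedSumSquares_apply, ← eι.sum_comp, Finset.mul_sum]
  refine Finset.sum_congr rfl fun i _ => ?_
  have h5 : √(2 * w (eι i)) * √(2 * w (eι i)) = 2 * w (eι i) :=
    Real.mul_self_sqrt (by have := hw (eι i); positivity)
  have h6 := (hw (eι i)).ne'
  simp only [Equiv.symm_apply_apply, smul_eq_mul, div_mul_div_comm, h5]
  field_simp

/-- Every flag with positive definite forms on its subquotients has a frame. -/
theorem exists_frame {I : CompositionAsSet n} (W : Flag I) (R : Forms W) :
    ∃ g : GL (Fin n) ℝ, IsFrame g W R := by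
  classical
  have hb : ∀ k : Fin I.length, ∃ b : {i // blk I i = k} → W.Subquot k, ∀ c : {i // blk I i = k} → ℝ,
      (R k).1 (∑ i, c i • b i) = 1 / 2 * ∑ i, c i ^ 2 := by
    intro k
    refine exists_orthonormal_family (R k).2 ?_
    have h1 := W.finrank_subquot k
    have h2 := card_blk_eq I k
    rw [Fintype.card_subtype]
    omega
  choose b hb using hb
  have hf : ∀ i : Fin n, ∃ v : W.1 (blk I i).castSucc, Submodule.Quotient.mk v = b (blk I i) ⟨i, rfl⟩ :=
    fun i => Submodule.Quotient.mk_surjective _ _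
  choose f hf using hf
  have hmem : ∀ (i : Fin n) (k : Fin (I.length + 1)), k ≤ (blk I i).castSucc → (f i : Fin n → ℝ) ∈ W.1 k :=
    fun i k hk => W.2.1 hk (f i).2
  -- Modulo `W_{k+1}` only the terms of block `k` survive, and their classes are orthonormal up to
  -- the factor `1 / 2`.
  have key : ∀ (k : Fin I.length) (c : Fin n → ℝ), (∀ i, blk I i < k → c i = 0) →
      ∀ v : W.1 k.castSucc, (v : Fin n → ℝ) = ∑ i, c i • (f i : Fin n → ℝ) →
        (R k).1 (Submodule.Quotient.mk v) = 1 / 2 * ∑ i, if blk I i = k then c i ^ 2 else 0 := by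
    intro k c hc v hv
    let v' : W.1 k.castSucc := ∑ i : {i // blk I i = k}, c i • ⟨f i, hmem i _ (by rw [i.2])⟩
    have h1 : (Submodule.Quotient.mk v' : W.Subquot k) = ∑ i : {i // blk I i = k}, c i • b k i := by
      change Submodule.mkQ _ _ = _
      simp only [v', map_sum, map_smul]
      refine Finset.sum_congr rfl fun ⟨i, hi⟩ _ => ?_
      subst hi
      rw [← hf i]
      rfl
    have h2 : (Submodule.Quotient.mk v : W.Subquot k) = Submodule.Quotient.mk v' := by
      rw [← sub_eq_zero, ← Submodule.Quotient.mk_sub, W.mk_eq_zero_iff]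
      have h3 : ((v - v' : W.1 k.castSucc) : Fin n → ℝ) =
          ∑ i, if blk I i = k then 0 else c i • (f i : Fin n → ℝ) := by
        rw [Submodule.coe_sub, hv]
        simp only [v', Submodule.coe_sum, Submodule.coe_smul]
        have h4 : ∑ i : {i // blk I i = k}, c i • (f i : Fin n → ℝ) =
            ∑ i, if blk I i = k then c i • (f i : Fin n → ℝ) else 0 := by
          rw [← Finset.sum_filter]
          exact (Finset.sum_subtype _ (by simp) fun i => c i • (f i : Fin n → ℝ)).symm
        refine (congrArg (_ - ·) h4).trans ?_
        rw [← Finset.sum_sub_distrib]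
        refine Finset.sum_congr rfl fun i _ => ?_
        split_ifs <;> simp
      rw [h3]
      refine Submodule.sum_mem _ fun i _ => ?_
      split_ifs with h
      · exact Submodule.zero_mem _
      · rcases lt_or_gt_of_ne h with h | h
        · rw [hc i h, zero_smul]
          exact Submodule.zero_mem _
        · exact Submodule.smul_mem _ _ (hmem i _ (Fin.succ_le_castSucc_iff.2 h))
    rw [h2, h1, hb k fun i => c i]
    congr 1
    rw [← Finset.sum_filter]
    exact (Finset.sum_subtype _ (by simp) fun i => c i ^ 2).symm
  -- Induction over blocks: once the earlier coefficients vanish, the sum lies in the next term of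
  -- the flag, so its form on the current subquotient, half the sum of squares of that block's
  -- coefficients, is zero.
  have hzero : ∀ (k : Fin (I.length + 1)) (c : Fin n → ℝ), ∑ i, c i • (f i : Fin n → ℝ) ∈ W.1 k →
      ∀ i, (blk I i).castSucc < k → c i = 0 := by
    intro k c hc
    have : ∀ m : ℕ, ∀ i, (blk I i : ℕ) = m → (blk I i).castSucc < k → c i = 0 := by
      intro m
      induction m using Nat.strong_induction_on with
      | _ m ih =>
        intro i him hik
        have hlow : ∀ j, blk I j < blk I i → c j = 0 := fun j hj =>
          ih (blk I j) (him ▸ hj) j rfl (lt_trans (Fin.castSucc_lt_castSucc_iff.2 hj) hik)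
        have h1 := key (blk I i) c hlow ⟨_, W.2.1 hik.le hc⟩ rfl
        rw [(W.mk_eq_zero_iff _).2 (W.2.1 (Fin.castSucc_lt_iff_succ_le.1 hik) hc),
          QuadraticMap.map_zero] at h1
        have h2 : ∑ j, (if blk I j = blk I i then c j ^ 2 else 0) = 0 := by linarith
        rw [Finset.sum_eq_zero_iff_of_nonneg fun j _ => by split_ifs <;> positivity] at h2
        simpa using h2 i (Finset.mem_univ i)
    exact fun i hi => this _ i rfl hi
  let F : Matrix (Fin n) (Fin n) ℝ := Matrix.of fun i => (f i : Fin n → ℝ)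
  have hF : IsUnit F := by
    rw [← Matrix.linearIndependent_rows_iff_isUnit, Fintype.linearIndependent_iff]
    intro c hc i
    refine hzero (Fin.last _) c ?_ i (Fin.castSucc_lt_last _)
    change ∑ i, c i • (f i : Fin n → ℝ) = 0 at hc
    rw [hc]
    exact Submodule.zero_mem _
  obtain ⟨p, hp⟩ := hF
  have hexp : ∀ v : Fin n → ℝ, v = ∑ i, (((p⁻¹ : GL (Fin n) ℝ) : Matrix (Fin n) (Fin n) ℝ)ᵀ *ᵥ v) i •
      (f i : Fin n → ℝ) := by
    intro v
    have h1 : Fᵀ *ᵥ (((p⁻¹ : GL (Fin n) ℝ) : Matrix (Fin n) (Fin n) ℝ)ᵀ *ᵥ v) = v := by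
      rw [Matrix.mulVec_mulVec, ← Matrix.transpose_mul, ← hp, Units.inv_mul, Matrix.transpose_one,
        Matrix.one_mulVec]
    conv_lhs => rw [← h1]
    rw [Matrix.mulVec_transpose]
    ext j
    simp [Matrix.vecMul, dotProduct, F]
  -- The rows of `p` are the lifted basis, so the transpose of `p⁻¹` computes the coordinates in
  -- that basis.
  refine ⟨p⁻¹, fun k v => ⟨fun hv => ?_, fun hv => ?_⟩, fun k v => ?_⟩
  · refine hzero k _ ?_
    rwa [← hexp v]
  · rw [hexp v]
    refine Submodule.sum_mem _ fun i _ => ?_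
    rcases lt_or_ge (blk I i).castSucc k with h | h
    · rw [hv i h, zero_smul]
      exact Submodule.zero_mem _
    · exact Submodule.smul_mem _ _ (hmem i k h)
  · refine key k _ (fun i hi => ?_) v (hexp v)
    refine hzero k.castSucc _ ?_ i (Fin.castSucc_lt_castSucc_iff.2 hi)
    rw [← hexp v]
    exact v.2

/-! ### Growth of the quadratic form along a geodesic -/

theorem quadForm_expCurve (g : GL (Fin n) ℝ) (φ : Fin n → ℝ) (t : ℝ) (v : Fin n → ℝ) :
    quadForm (expCurve g φ t) v =
      1 / 2 * ∑ i, Real.exp (φ i * t) * ((g : Matrix (Fin n) (Fin n) ℝ)ᵀ *ᵥ v) i ^ 2 := by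
  rw [expCurve, quadForm_conj, quadForm_diagonal]

theorem tendsto_exp_neg_mul {α : Type*} {l : Filter α} {t : α → ℝ} (ht : Tendsto t l atTop) {a : ℝ}
    (ha : a < 0) : Tendsto (fun x => Real.exp (a * t x)) l (𝓝 0) :=
  Real.tendsto_exp_atBot.comp (ht.const_mul_atTop_of_neg ha)

/-- After rescaling by `e^{-ψ_k t}`, block `k` has coefficient `1` and later blocks decay. Earlier
blocks have growing coefficients, so smallness of their coordinates is a hypothesis; it holds
exactly on the flag and exponentially on spectral subspaces. -/
theorem tendsto_rescaled_sum {α : Type*} {l : Filter α} {t : α → ℝ} (ht : Tendsto t l atTop)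
    {I : CompositionAsSet n} (ψ : Speeds I) (k : Fin I.length) {x : α → Fin n → ℝ} {y : Fin n → ℝ}
    (hx : Tendsto x l (𝓝 y))
    (hlow : ∀ i, blk I i < k →
      Tendsto (fun a => Real.exp ((ψ.1 (blk I i) - ψ.1 k) * t a) * x a i ^ 2) l (𝓝 0)) :
    Tendsto (fun a => Real.exp (-(ψ.1 k * t a)) *
        (1 / 2 * ∑ i, Real.exp (ψ.1 (blk I i) * t a) * x a i ^ 2)) l
      (𝓝 (1 / 2 * ∑ i, if blk I i = k then y i ^ 2 else 0)) := by
  have h1 : ∀ a, Real.exp (-(ψ.1 k * t a)) *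
      (1 / 2 * ∑ i, Real.exp (ψ.1 (blk I i) * t a) * x a i ^ 2) =
      1 / 2 * ∑ i, Real.exp ((ψ.1 (blk I i) - ψ.1 k) * t a) * x a i ^ 2 := by
    intro a
    rw [mul_left_comm, Finset.mul_sum]
    congr 1
    refine Finset.sum_congr rfl fun i _ => ?_
    rw [← mul_assoc, ← Real.exp_add]
    congr 2
    ring
  simp only [h1]
  refine Tendsto.const_mul _ (tendsto_finsetSum _ fun i _ => ?_)
  have hxi : Tendsto (fun a => x a i ^ 2) l (𝓝 (y i ^ 2)) := (tendsto_pi_nhds.1 hx i).pow 2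
  rcases lt_trichotomy (blk I i) k with h | h | h
  · rw [if_neg h.ne]
    exact hlow i h
  · rw [if_pos h]
    simpa [h] using hxi
  · rw [if_neg h.ne']
    simpa using (tendsto_exp_neg_mul ht (sub_neg.2 (ψ.2.1 h))).mul hxi

/-- `μ` is represented by a frame of the flag `W` with the forms `R`, with speeds `ψ`. -/
def IsModel (μ : ParamGeodesic n) {I : CompositionAsSet n} (ψ : Speeds I) (W : Flag I)
    (R : Forms W) : Prop :=
  ∃ g : GL (Fin n) ℝ, (μ.toFun = expCurve g fun i => ψ.1 (blk I i)) ∧ IsFrame g W R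

theorem IsModel.tendsto {μ : ParamGeodesic n} {I : CompositionAsSet n} {ψ : Speeds I} {W : Flag I}
    {R : Forms W} (h : IsModel μ ψ W R) {α : Type*} {l : Filter α} {t : α → ℝ}
    (ht : Tendsto t l atTop) {k : Fin I.length} (v : W.1 k.castSucc) :
    Tendsto (fun a => Real.exp (-(ψ.1 k * t a)) * quadForm (μ.toFun (t a)) v) l
      (𝓝 ((R k).1 (Submodule.Quotient.mk v))) := by
  obtain ⟨g, hg, hf⟩ := h
  rw [hf.form_eq, hg]
  simp only [quadForm_expCurve]
  refine tendsto_rescaled_sum ht ψ k tendsto_const_nhds fun i hi => ?_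
  rw [(hf.mem_iff _ _).1 v.2 i (Fin.castSucc_lt_castSucc_iff.2 hi)]
  simpa using tendsto_const_nhds

/-- The vector `v` belongs to `W_k` but not to `W_{k+1}`. -/
def Flag.IsLevel {I : CompositionAsSet n} (W : Flag I) (v : Fin n → ℝ) (k : Fin I.length) : Prop :=
  v ∈ W.1 k.castSucc ∧ v ∉ W.1 k.succ

theorem Flag.exists_isLevel {I : CompositionAsSet n} (W : Flag I) {v : Fin n → ℝ} (hv : v ≠ 0) :
    ∃ k, W.IsLevel v k :=
  exists_switch (p := fun k => v ∈ W.1 k) (by simp [W.zero_eq_top]) (by simpa [W.last_eq_bot] using hv)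

theorem Flag.IsLevel.ne_zero {I : CompositionAsSet n} {W : Flag I} {v : Fin n → ℝ} {k : Fin I.length}
    (h : W.IsLevel v k) : v ≠ 0 := by
  rintro rfl
  exact h.2 (Submodule.zero_mem _)

theorem Flag.IsLevel.mem_iff {I : CompositionAsSet n} {W : Flag I} {v : Fin n → ℝ} {k : Fin I.length}
    (h : W.IsLevel v k) (j : Fin (I.length + 1)) : v ∈ W.1 j ↔ j ≤ k.castSucc := by
  refine ⟨fun hj => ?_, fun hj => W.2.1 hj h.1⟩
  by_contra! hlt
  exact h.2 (W.2.1 (Fin.castSucc_lt_iff_succ_le.1 hlt) hj)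

theorem Flag.exists_of_level {I : CompositionAsSet n} (W : Flag I) (k : Fin I.length) :
    ∃ v, W.IsLevel v k := by
  by_contra! h
  have hle : W.1 k.castSucc ≤ W.1 k.succ := by
    intro v hv
    by_contra hv'
    exact h v ⟨hv, hv'⟩
  have h1 := Submodule.finrank_mono hle
  have h2 := W.2.2 k.castSucc
  have h3 := W.2.2 k.succ
  have h4 := (cut_lt_cut_iff I).2 (Fin.castSucc_lt_succ (i := k))
  omega

theorem Flag.IsLevel.form_pos {I : CompositionAsSet n} {W : Flag I} {v : Fin n → ℝ} {k : Fin I.length}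
    (h : W.IsLevel v k) (R : Forms W) : 0 < (R k).1 (Submodule.Quotient.mk ⟨v, h.1⟩) :=
  (R k).2 _ fun h0 => h.2 ((W.mk_eq_zero_iff ⟨v, h.1⟩).1 h0)

/-- The asymptotic expansion of `log Q(v)`: its slope detects the level of `v` in the flag, and its
constant term the value of the form. -/
theorem IsModel.tendsto_log {μ : ParamGeodesic n} {I : CompositionAsSet n} {ψ : Speeds I} {W : Flag I}
    {R : Forms W} (h : IsModel μ ψ W R) {α : Type*} {l : Filter α} {t : α → ℝ}
    (ht : Tendsto t l atTop) {k : Fin I.length} {v : Fin n → ℝ} (hv : W.IsLevel v k) :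
    Tendsto (fun a => Real.log (quadForm (μ.toFun (t a)) v) - ψ.1 k * t a) l
      (𝓝 (Real.log ((R k).1 (Submodule.Quotient.mk ⟨v, hv.1⟩)))) := by
  refine ((h.tendsto ht ⟨v, hv.1⟩).log (hv.form_pos R).ne').congr fun a => ?_
  rw [Real.log_mul (Real.exp_pos _).ne' (quadForm_pos (μ.posDef _) hv.ne_zero).ne', Real.log_exp]
  ring

/-! ### Comparison of the data of two asymptotic geodesics -/

theorem Speeds.exists_ne_zero {I : CompositionAsSet n} (ψ : Speeds I) : ∃ k, ψ.1 k ≠ 0 :=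
  Function.ne_iff.1 ψ.2.2

/-- Geodesics whose quadratic forms are asymptotic along sequences of times have proportional
speeds and forms. -/
theorem IsModel.compare {μ ν : ParamGeodesic n} {I I' : CompositionAsSet n} {ψ : Speeds I}
    {ψ' : Speeds I'} {W : Flag I} {W' : Flag I'} {R : Forms W} {R' : Forms W'}
    (hμ : IsModel μ ψ W R) (hν : IsModel ν ψ' W' R') {t s : ℕ → ℝ} (ht : Tendsto t atTop atTop)
    (hs : Tendsto s atTop atTop)
    (h : ∀ v : Fin n → ℝ, v ≠ 0 → Tendsto (fun N => Real.log (quadForm (ν.toFun (s N)) v) -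
      Real.log (quadForm (μ.toFun (t N)) v)) atTop (𝓝 0)) :
    ∃ a c : ℝ, 0 < a ∧ ∀ v k k' (hk : W.IsLevel v k) (hk' : W'.IsLevel v k'),
      ψ.1 k = a * ψ'.1 k' ∧ (R' k').1 (Submodule.Quotient.mk ⟨v, hk'.1⟩) =
        Real.exp (ψ'.1 k' * c) * (R k).1 (Submodule.Quotient.mk ⟨v, hk.1⟩) := by
  -- Subtraction of the two expansions eliminates the quadratic forms.
  have key : ∀ v k k' (hk : W.IsLevel v k) (hk' : W'.IsLevel v k'),
      Tendsto (fun N => ψ.1 k * t N - ψ'.1 k' * s N) atTop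
        (𝓝 (Real.log ((R' k').1 (Submodule.Quotient.mk ⟨v, hk'.1⟩)) -
          Real.log ((R k).1 (Submodule.Quotient.mk ⟨v, hk.1⟩)))) := by
    intro v k k' hk hk'
    have := ((hν.tendsto_log hs hk').sub (hμ.tendsto_log ht hk)).sub (h v hk.ne_zero)
    rw [sub_zero] at this
    refine this.congr fun N => ?_
    ring
  have key2 : ∀ v k k', W.IsLevel v k → W'.IsLevel v k' →
      Tendsto (fun N => ψ.1 k - ψ'.1 k' * (s N / t N)) atTop (𝓝 0) := by
    intro v k k' hk hk'
    refine ((key v k k' hk hk').div_atTop ht).congr' ?_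
    filter_upwards [ht.eventually_gt_atTop 0] with N hN
    field_simp
  -- A level of nonzero speed determines the limit `a` of `s / t`. Positivity of `a` comes from both
  -- times tending to `+∞`.
  obtain ⟨k0, hk0⟩ := ψ.exists_ne_zero
  obtain ⟨v0, hv0⟩ := W.exists_of_level k0
  obtain ⟨k0', hv0'⟩ := W'.exists_isLevel hv0.ne_zero
  have h0 := key2 v0 k0 k0' hv0 hv0'
  have hne : ψ'.1 k0' ≠ 0 := by
    intro hz
    simp only [hz, zero_mul, sub_zero] at h0
    exact hk0 (tendsto_nhds_unique tendsto_const_nhds h0)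
  have hst : Tendsto (fun N => s N / t N) atTop (𝓝 (ψ.1 k0 / ψ'.1 k0')) := by
    have h1 := ((h0.const_sub (ψ.1 k0)).div_const (ψ'.1 k0'))
    simp only [sub_sub_cancel, sub_zero] at h1
    refine h1.congr fun N => ?_
    field_simp
  set a := ψ.1 k0 / ψ'.1 k0' with ha
  have ha0 : 0 < a := by
    refine lt_of_le_of_ne (ge_of_tendsto hst ?_) (div_ne_zero hk0 hne).symm
    filter_upwards [ht.eventually_gt_atTop 0, hs.eventually_gt_atTop 0] with N h1 h2
    positivity
  have hprop : ∀ v k k', W.IsLevel v k → W'.IsLevel v k' → ψ.1 k = a * ψ'.1 k' := by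
    intro v k k' hk hk'
    have h1 := tendsto_nhds_unique (key2 v k k' hk hk') ((hst.const_mul (ψ'.1 k')).const_sub (ψ.1 k))
    linarith
  have key3 : ∀ v k k' (hk : W.IsLevel v k) (hk' : W'.IsLevel v k'),
      Tendsto (fun N => ψ'.1 k' * (a * t N - s N)) atTop
        (𝓝 (Real.log ((R' k').1 (Submodule.Quotient.mk ⟨v, hk'.1⟩)) -
          Real.log ((R k).1 (Submodule.Quotient.mk ⟨v, hk.1⟩)))) := by
    intro v k k' hk hk'
    refine (key v k k' hk hk').congr fun N => ?_
    rw [hprop v k k' hk hk']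
    ring
  have hc0 := (key3 v0 k0 k0' hv0 hv0').const_mul (ψ'.1 k0')⁻¹
  simp only [inv_mul_cancel_left₀ hne] at hc0
  -- The same time shift `c` serves all levels, so the forms differ by a single one-parameter
  -- rescaling.
  obtain ⟨c, hc⟩ : ∃ c, Tendsto (fun N => a * t N - s N) atTop (𝓝 c) := ⟨_, hc0⟩
  refine ⟨a, c, ha0, fun v k k' hk hk' => ⟨hprop v k k' hk hk', ?_⟩⟩
  rw [tendsto_nhds_unique (hc.const_mul (ψ'.1 k')) (key3 v k k' hk hk'), Real.exp_sub,
    Real.exp_log (hk'.form_pos R'), Real.exp_log (hk.form_pos R)]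
  have := (hk.form_pos R).ne'
  field_simp

/-- The terms of a flag are the sets of vectors whose growth rate does not exceed a given speed. The
growth rates for the two flags are proportional, so every such set for one occurs for the other. -/
theorem Flag.exists_eq_of_levels {I I' : CompositionAsSet n} {ψ : Speeds I} {ψ' : Speeds I'}
    {W : Flag I} {W' : Flag I'} {a : ℝ}
    (h : ∀ v k k', W.IsLevel v k → W'.IsLevel v k' → ψ.1 k = a * ψ'.1 k') (ha : 0 < a)
    (k : Fin (I.length + 1)) : ∃ k', W.1 k = W'.1 k' := by
  induction k using Fin.lastCases with
  | last => exact ⟨Fin.last _, by rw [W.last_eq_bot, W'.last_eq_bot]⟩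
  | cast k =>
    have hle : ∀ v l l', W.IsLevel v l → W'.IsLevel v l' → (k ≤ l ↔ a * ψ'.1 l' ≤ ψ.1 k) := by
      intro v l l' hl hl'
      rw [← h v l l' hl hl']
      exact ψ.2.1.le_iff_ge.symm
    obtain ⟨v0, hv0⟩ := W.exists_of_level k
    obtain ⟨k0', hv0'⟩ := W'.exists_isLevel hv0.ne_zero
    -- The required index is the first one in the second flag whose rescaled speed is at most `ψ k`.
    obtain ⟨j, hj1, hj2⟩ := exists_switch
      (p := fun j => ∀ l : Fin I'.length, l.castSucc < j → ψ.1 k < a * ψ'.1 l)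
      (fun l hl => absurd hl (Fin.not_lt_zero _))
      (fun hp => not_le.2 (hp k0' (Fin.castSucc_lt_last _)) ((hle v0 k k0' hv0 hv0').1 le_rfl))
    push Not at hj2
    obtain ⟨l, hl1, hl2⟩ := hj2
    have hlj : l = j := by
      refine le_antisymm (Fin.castSucc_lt_succ_iff.1 hl1) (not_lt.1 fun hlt => ?_)
      exact not_lt.2 hl2 (hj1 l (Fin.castSucc_lt_castSucc_iff.2 hlt))
    subst hlj
    refine ⟨l.castSucc, ?_⟩
    ext v
    by_cases hv : v = 0
    · rw [hv]
      exact iff_of_true (Submodule.zero_mem _) (Submodule.zero_mem _)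
    obtain ⟨i, hi⟩ := W.exists_isLevel hv
    obtain ⟨i', hi'⟩ := W'.exists_isLevel hv
    rw [hi.mem_iff, hi'.mem_iff, Fin.castSucc_le_castSucc_iff, Fin.castSucc_le_castSucc_iff,
      hle v i i' hi hi']
    constructor
    · intro h1
      by_contra! h2
      exact not_lt.2 h1 (hj1 i' (Fin.castSucc_lt_castSucc_iff.2 h2))
    · intro h1
      refine le_trans ?_ hl2
      exact mul_le_mul_of_nonneg_left (ψ'.2.1.antitone h1) ha.le

theorem boundaries_subset {I I' : CompositionAsSet n} {W : Flag I} {W' : Flag I'}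
    (h : ∀ k, ∃ k', W.1 k = W'.1 k') : I.boundaries ⊆ I'.boundaries := by
  intro j hj
  obtain ⟨k, rfl⟩ := (mem_boundaries_iff I j).1 hj
  obtain ⟨k', hk'⟩ := h k
  refine (mem_boundaries_iff I' _).2 ⟨k', Fin.ext ?_⟩
  have h1 := W.2.2 k
  have h2 := W'.2.2 k'
  rw [hk'] at h1
  omega

/-- `μ` is represented by a frame with boundary datum `b`. -/
def IsDatum (μ : ParamGeodesic n) (b : BoundaryData n) : Prop :=
  ∃ (ψ : Speeds b.I) (R : Forms b.W), IsModel μ ψ b.W R ∧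
    ψ.toSimplex = b.δ ∧ Quotient.mk (formsSetoid b.δ b.W) R = b.R

/-- Equal flag terms have equal codimensions, which identifies `I`, then the flags index by index.
Only after these substitutions can the speeds and forms be compared within one type. -/
theorem IsDatum.eq_of_asymptotic {μ ν : ParamGeodesic n} {b b' : BoundaryData n}
    (hμ : IsDatum μ b) (hν : IsDatum ν b') {t s : ℕ → ℝ} (ht : Tendsto t atTop atTop)
    (hs : Tendsto s atTop atTop)
    (h : ∀ v : Fin n → ℝ, v ≠ 0 → Tendsto (fun N => Real.log (quadForm (ν.toFun (s N)) v) -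
      Real.log (quadForm (μ.toFun (t N)) v)) atTop (𝓝 0)) : b = b' := by
  obtain ⟨I, δ, W, Rc⟩ := b
  obtain ⟨I', δ', W', Rc'⟩ := b'
  obtain ⟨ψ, R, hm, hδ, hR⟩ := hμ
  obtain ⟨ψ', R', hm', hδ', hR'⟩ := hν
  obtain ⟨a, c, ha, hcmp⟩ := hm.compare hm' ht hs h
  dsimp only at ψ R ψ' R' hδ hR hδ' hR' hm hm' hcmp
  have hlev : ∀ v k k', W.IsLevel v k → W'.IsLevel v k' → ψ.1 k = a * ψ'.1 k' :=
    fun v k k' hk hk' => (hcmp v k k' hk hk').1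
  have hlev' : ∀ v k' k, W'.IsLevel v k' → W.IsLevel v k → ψ'.1 k' = a⁻¹ * ψ.1 k := by
    intro v k' k hk' hk
    rw [hlev v k k' hk hk']
    field_simp
  have hr := Flag.exists_eq_of_levels hlev ha
  have hI : I = I' := CompositionAsSet.ext <| (boundaries_subset hr).antisymm
    (boundaries_subset (Flag.exists_eq_of_levels hlev' (inv_pos.2 ha)))
  subst hI
  have hW : W = W' := by
    refine Subtype.ext (funext fun k => ?_)
    obtain ⟨k', hk'⟩ := hr k
    have h1 := W.2.2 k
    have h2 := W'.2.2 k'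
    rw [hk'] at h1
    have h3 : cut I k = cut I k' := Fin.ext (by omega)
    rw [(cut_strictMono I).injective h3] at hk' ⊢
    exact hk'
  subst hW
  have hψ : ∀ k, ψ.1 k = a * ψ'.1 k := fun k => by
    obtain ⟨v, hv⟩ := W.exists_of_level k
    exact hlev v k k hv hv
  have hδδ : δ = δ' := by
    rw [← hδ, ← hδ']
    exact Quotient.sound ((speedsSetoid I).symm ⟨a, ha, hψ⟩)
  subst hδδ
  have hRR : Rc = Rc' := by
    rw [← hR, ← hR']
    refine Quotient.sound ⟨ψ', hδ', c, fun k x => ?_⟩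
    obtain ⟨v, rfl⟩ := Submodule.Quotient.mk_surjective _ x
    by_cases hv : (v : Fin n → ℝ) ∈ W.1 k.succ
    · rw [(W.mk_eq_zero_iff v).2 hv, QuadraticMap.map_zero, QuadraticMap.map_zero, mul_zero]
    · exact (hcmp v k k ⟨v.2, hv⟩ ⟨v.2, hv⟩).2
  rw [hRR]

/-- A geodesic is compared with itself at equal times. -/
theorem IsDatum.unique {μ : ParamGeodesic n} {b b' : BoundaryData n} (h : IsDatum μ b)
    (h' : IsDatum μ b') : b = b' :=
  h.eq_of_asymptotic h' tendsto_natCast_atTop_atTop tendsto_natCast_atTop_atTop fun v _ => by simp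

theorem IsDatum.eq_of_nullAsymptotic {μ ν : ParamGeodesic n} {b b' : BoundaryData n}
    (hμ : IsDatum μ b) (hν : IsDatum ν b') (h : NullAsymptotic μ ν) : b = b' := by
  obtain ⟨t, s, ht, hs, hr⟩ := h.exists_seq
  refine hμ.eq_of_asymptotic hν ht hs fun v hv => ?_
  exact squeeze_zero_norm (fun N => log_quadForm_sub_le_rho (μ.posDef _) (ν.posDef _) hv) hr

/-! ### Geodesics with the same boundary datum -/

theorem eq_zero_of_quadForm {M : Matrix (Fin n) (Fin n) ℝ} (hM : M.IsSymm)
    (h : ∀ v, quadForm M v = 0) : M = 0 := by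
  have hd : ∀ v, v ⬝ᵥ M *ᵥ v = 0 := fun v => by
    have := h v
    rw [quadForm_eq] at this
    linarith
  ext i j
  have h1 := hd (Pi.single i 1 + Pi.single j 1)
  have h2 := hd (Pi.single i 1)
  have h3 := hd (Pi.single j 1)
  simp only [Matrix.mulVec_add, dotProduct_add, add_dotProduct, Matrix.mulVec_single_one,
    single_one_dotProduct, Matrix.col_apply] at h1 h2 h3
  have h4 := hM.apply i j
  simp only [Matrix.zero_apply]
  linarith

theorem mul_transpose_mulVec (g : GL (Fin n) ℝ) (x : Fin n → ℝ) :
    (g : Matrix (Fin n) (Fin n) ℝ)ᵀ *ᵥ ((g : Matrix (Fin n) (Fin n) ℝ)⁻¹ᵀ *ᵥ x) = x := by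
  rw [Matrix.mulVec_mulVec, gl_transpose_mul_inv, Matrix.one_mulVec]

/-- The transition matrix between two frames of the same flag is block triangular. -/
theorem IsFrame.transition_eq_zero {I : CompositionAsSet n} {g h : GL (Fin n) ℝ} {W : Flag I}
    {R R' : Forms W} (hg : IsFrame g W R) (hh : IsFrame h W R') {i j : Fin n}
    (hij : blk I i < blk I j) :
    ((h : Matrix (Fin n) (Fin n) ℝ)ᵀ * (g : Matrix (Fin n) (Fin n) ℝ)⁻¹ᵀ) i j = 0 := by
  have h1 := (hg.mem_iff (blk I j).castSucc
    ((g : Matrix (Fin n) (Fin n) ℝ)⁻¹ᵀ *ᵥ Pi.single j 1)).2 fun l hl => by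
      rw [mul_transpose_mulVec]
      have : l ≠ j := by
        rintro rfl
        exact lt_irrefl _ hl
      simp [this]
  have h2 := (hh.mem_iff _ _).1 h1 i (Fin.castSucc_lt_castSucc_iff.2 hij)
  rw [Matrix.mulVec_mulVec, Matrix.mulVec_single_one] at h2
  exact h2

/-- The diagonal blocks of the transition matrix between two frames carry the forms into each
other. -/
theorem IsFrame.sum_sq_transition {I : CompositionAsSet n} {g h : GL (Fin n) ℝ} {W : Flag I}
    {R R' : Forms W} (hg : IsFrame g W R) (hh : IsFrame h W R') {w : Fin I.length → ℝ}
    (hR : ∀ k x, w k * (R' k).1 x = (R k).1 x) (x : Fin n → ℝ) :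
    ∑ i, w (blk I i) * (∑ j, if blk I i = blk I j then
      ((h : Matrix (Fin n) (Fin n) ℝ)ᵀ * (g : Matrix (Fin n) (Fin n) ℝ)⁻¹ᵀ) i j * x j else 0) ^ 2 =
      ∑ i, x i ^ 2 := by
  have hk : ∀ k : Fin I.length, ∑ i, (if blk I i = k then w (blk I i) * (∑ j, if blk I i = blk I j then
      ((h : Matrix (Fin n) (Fin n) ℝ)ᵀ * (g : Matrix (Fin n) (Fin n) ℝ)⁻¹ᵀ) i j * x j else 0) ^ 2 else 0) =
      ∑ i, if blk I i = k then x i ^ 2 else 0 := by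
    intro k
    -- The vector whose `g`-coordinates are the block `k` of `x` lies in `W_k`; its form is
    -- evaluated in both frames.
    set y : Fin n → ℝ := fun j => if blk I j = k then x j else 0 with hy
    have hmem : (g : Matrix (Fin n) (Fin n) ℝ)⁻¹ᵀ *ᵥ y ∈ W.1 k.castSucc := by
      rw [hg.mem_iff]
      intro i hi
      rw [mul_transpose_mulVec, hy]
      exact if_neg (Fin.castSucc_lt_castSucc_iff.1 hi).ne
    have h1 := hg.form_eq k ⟨_, hmem⟩
    have h2 := hh.form_eq k ⟨_, hmem⟩
    rw [← hR, h2] at h1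
    simp only [mul_transpose_mulVec] at h1
    have h3 : ∀ i, (if blk I i = k then w (blk I i) * (∑ j, if blk I i = blk I j then
        ((h : Matrix (Fin n) (Fin n) ℝ)ᵀ * (g : Matrix (Fin n) (Fin n) ℝ)⁻¹ᵀ) i j * x j else 0) ^ 2 else 0) =
        w k * (if blk I i = k then ((h : Matrix (Fin n) (Fin n) ℝ)ᵀ *ᵥ
          ((g : Matrix (Fin n) (Fin n) ℝ)⁻¹ᵀ *ᵥ y)) i ^ 2 else 0) := by
      intro i
      split_ifs with hi
      · rw [hi, Matrix.mulVec_mulVec]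
        congr 2
        rw [Matrix.mulVec, dotProduct]
        refine Finset.sum_congr rfl fun j _ => ?_
        rw [hy]
        simp only [mul_ite, mul_zero, eq_comm (a := k)]
      · rw [mul_zero]
    have h4 : ∀ i, (if blk I i = k then x i ^ 2 else 0) = if blk I i = k then y i ^ 2 else 0 := by
      intro i
      split_ifs with hi
      · rw [hy]
        simp only [if_pos hi]
      · rfl
    rw [Finset.sum_congr rfl fun i _ => h3 i, ← Finset.mul_sum, Finset.sum_congr rfl fun i _ => h4 i]
    linarith
  have hsum : ∀ f : Fin n → ℝ, ∑ k, ∑ i, (if blk I i = k then f i else 0) = ∑ i, f i := by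
    intro f
    rw [Finset.sum_comm]
    simp
  rw [← hsum, ← hsum fun i => x i ^ 2]
  exact Finset.sum_congr rfl fun k _ => hk k

/-- Congruence by `G(t)⁻¹`, where `μ(t) = G(t) G(t)ᵀ`, sends the first geodesic to the identity and
the second to `Y(t)`. It suffices that `Y(t) → 1`, because congruence does not increase distance. -/
theorem IsFrame.tendsto_rho {I : CompositionAsSet n} {g h : GL (Fin n) ℝ} {W : Flag I}
    {R R' : Forms W} (hg : IsFrame g W R) (hh : IsFrame h W R') (ψ : Speeds I) (c : ℝ)
    (hR : ∀ k x, Real.exp (-(ψ.1 k * c)) * (R' k).1 x = (R k).1 x) :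
    Tendsto (fun t => rho (expCurve g (fun i => ψ.1 (blk I i)) t)
      (expCurve h (fun i => ψ.1 (blk I i)) (t - c))) atTop (𝓝 0) := by
  set φ : Fin n → ℝ := fun i => ψ.1 (blk I i) with hφ
  set A : Matrix (Fin n) (Fin n) ℝ :=
    (h : Matrix (Fin n) (Fin n) ℝ)ᵀ * (g : Matrix (Fin n) (Fin n) ℝ)⁻¹ᵀ with hA
  let E (t : ℝ) : GL (Fin n) ℝ :=
    ⟨Matrix.diagonal fun i => Real.exp (φ i * t / 2), Matrix.diagonal fun i => Real.exp (-(φ i * t / 2)),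
      by simp [← Real.exp_add], by simp [← Real.exp_add]⟩
  let G (t : ℝ) : GL (Fin n) ℝ := g * E t
  let Y (t : ℝ) : Matrix (Fin n) (Fin n) ℝ := ((G t)⁻¹ : GL (Fin n) ℝ) * expCurve h φ (t - c) *
    (((G t)⁻¹ : GL (Fin n) ℝ) : Matrix (Fin n) (Fin n) ℝ)ᵀ
  have hYpos : ∀ t, (Y t).PosDef := fun t => PosDef.conj (posDef_expCurve h φ _) _
  have hμ : ∀ t, expCurve g φ t = (G t : Matrix (Fin n) (Fin n) ℝ) * 1 *
      (G t : Matrix (Fin n) (Fin n) ℝ)ᵀ := by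
    intro t
    rw [expCurve, Matrix.mul_one]
    simp only [G, Units.val_mul, Matrix.transpose_mul, E, Matrix.diagonal_transpose]
    rw [Matrix.mul_assoc _ _ (_ * _), ← Matrix.mul_assoc (Matrix.diagonal _) (Matrix.diagonal _),
      Matrix.diagonal_mul_diagonal, ← Matrix.mul_assoc]
    simp only [← Real.exp_add, add_halves]
  have hν : ∀ t, expCurve h φ (t - c) = (G t : Matrix (Fin n) (Fin n) ℝ) * Y t *
      (G t : Matrix (Fin n) (Fin n) ℝ)ᵀ := by
    intro t
    simp only [Y]
    have e1 : (((G t)⁻¹ : GL (Fin n) ℝ) : Matrix (Fin n) (Fin n) ℝ)ᵀ *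
        (G t : Matrix (Fin n) (Fin n) ℝ)ᵀ = 1 := by
      rw [← Matrix.transpose_mul, Units.mul_inv, Matrix.transpose_one]
    simp only [Matrix.mul_assoc]
    rw [e1, Matrix.mul_one, ← Matrix.mul_assoc, Units.mul_inv, Matrix.one_mul]
  have hYe : ∀ t j l, Y t j l = ∑ i, Real.exp (-(φ i * c)) *
      (Real.exp ((φ i - φ j) * t / 2) * A i j) * (Real.exp ((φ i - φ l) * t / 2) * A i l) := by
    intro t j l
    have hGi : (((G t)⁻¹ : GL (Fin n) ℝ) : Matrix (Fin n) (Fin n) ℝ) =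
        Matrix.diagonal (fun i => Real.exp (-(φ i * t / 2))) * (g : Matrix (Fin n) (Fin n) ℝ)⁻¹ := by
      have e : (G t)⁻¹ = (E t)⁻¹ * g⁻¹ := _root_.mul_inv_rev _ _
      rw [e, Units.val_mul, Matrix.coe_units_inv g]
      rfl
    have hAt : Aᵀ = (g : Matrix (Fin n) (Fin n) ℝ)⁻¹ * (h : Matrix (Fin n) (Fin n) ℝ) := by
      rw [hA, Matrix.transpose_mul, Matrix.transpose_transpose, Matrix.transpose_transpose]
    have e : Y t = Matrix.diagonal (fun i => Real.exp (-(φ i * t / 2))) *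
        (Aᵀ * Matrix.diagonal (fun i => Real.exp (φ i * (t - c))) * A) *
        Matrix.diagonal (fun i => Real.exp (-(φ i * t / 2))) := by
      simp only [Y, hGi, expCurve, hAt, Matrix.transpose_mul, Matrix.diagonal_transpose]
      simp only [hA, Matrix.mul_assoc]
    rw [e, Matrix.mul_diagonal, Matrix.diagonal_mul, Matrix.mul_apply, Finset.mul_sum, Finset.sum_mul]
    refine Finset.sum_congr rfl fun i _ => ?_
    rw [Matrix.mul_diagonal, Matrix.transpose_apply]
    have e2 : Real.exp (-(φ i * c)) * Real.exp ((φ i - φ j) * t / 2) * Real.exp ((φ i - φ l) * t / 2) =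
        Real.exp (-(φ j * t / 2)) * Real.exp (φ i * (t - c)) * Real.exp (-(φ l * t / 2)) := by
      simp only [← Real.exp_add]
      congr 1
      ring
    linear_combination (-(A i j * A i l)) * e2
  -- Where the exponential grows, `A` vanishes by triangularity; where it decays, the entry dies
  -- out; diagonal blocks are unchanged.
  have hterm : ∀ i j, Tendsto (fun t : ℝ => Real.exp ((φ i - φ j) * t / 2) * A i j) atTop
      (𝓝 (if blk I i = blk I j then A i j else 0)) := by
    intro i j
    rcases lt_trichotomy (blk I i) (blk I j) with hij | hij | hij
    · rw [if_neg hij.ne, hA, hg.transition_eq_zero hh hij]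
      simp
    · rw [if_pos hij]
      simp [hφ, hij]
    · rw [if_neg hij.ne']
      have hneg : (φ i - φ j) / 2 < 0 := by
        have := ψ.2.1 hij
        simp only [hφ]
        linarith
      have := (tendsto_exp_neg_mul tendsto_id hneg).mul_const (A i j)
      simp only [id, zero_mul] at this
      refine this.congr fun t => ?_
      rw [div_mul_eq_mul_div]
  let B : Matrix (Fin n) (Fin n) ℝ := Matrix.of fun i j => if blk I i = blk I j then A i j else 0
  let Z : Matrix (Fin n) (Fin n) ℝ := Bᵀ * Matrix.diagonal (fun i => Real.exp (-(φ i * c))) * B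
  have hYZ : Tendsto Y atTop (𝓝 Z) := by
    rw [tendsto_matrix_iff]
    intro j l
    simp only [hYe, Z, Matrix.mul_apply (N := B), Matrix.mul_diagonal, Matrix.transpose_apply]
    refine tendsto_finsetSum _ fun i _ => ?_
    rw [mul_comm (B i j)]
    exact ((hterm i j).const_mul _).mul (hterm i l)
  -- The limit is determined by its quadratic form, and equality of that form with the standard one
  -- is the compatibility of the diagonal blocks with `R` and `R'`.
  have hZ : Z = 1 := by
    rw [← sub_eq_zero]
    refine eq_zero_of_quadForm ?_ fun x => ?_
    · refine Matrix.IsSymm.sub ?_ Matrix.isSymm_one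
      simp only [Z, Matrix.IsSymm, Matrix.transpose_mul, Matrix.transpose_transpose,
        Matrix.diagonal_transpose, Matrix.mul_assoc]
    · have h1 := hg.sum_sq_transition hh (w := fun k => Real.exp (-(ψ.1 k * c))) hR x
      rw [← hA] at h1
      have h2 : quadForm Z x = 1 / 2 * ∑ i, x i ^ 2 := by
        have := quadForm_conj Bᵀ (Matrix.diagonal (fun i => Real.exp (-(φ i * c)))) x
        rw [Matrix.transpose_transpose] at this
        rw [this, quadForm_diagonal, ← h1]
        congr 1
        refine Finset.sum_congr rfl fun i _ => ?_
        congr 2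
        rw [Matrix.mulVec, dotProduct]
        exact Finset.sum_congr rfl fun j _ => by simp [B]
      rw [quadForm_eq] at h2 ⊢
      rw [Matrix.sub_mulVec, dotProduct_sub, Matrix.one_mulVec, mul_sub, h2]
      simp [dotProduct, sq]
  rw [hZ] at hYZ
  refine squeeze_zero (fun t => rho_nonneg _ _) (fun t => ?_) (tendsto_rho_one hYpos hYZ)
  rw [hμ t, hν t]
  exact rho_conj_le Matrix.PosDef.one (hYpos t) (G t)

/-- The proportionality factor `a` of the speeds and the rescaling of the forms are absorbed by the
reparametrization `t ↦ a⁻¹ (t - a₀ s)` of `ν`. Here `a₀` accounts for the representative of the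
simplex point used in the equivalence of forms. -/
theorem IsDatum.nullAsymptotic {μ ν : ParamGeodesic n} {b : BoundaryData n}
    (hμ : IsDatum μ b) (hν : IsDatum ν b) : NullAsymptotic μ ν := by
  obtain ⟨ψ, R, ⟨g, hg, hgf⟩, hδ, hR⟩ := hμ
  obtain ⟨ψ', R', ⟨h, hh, hhf⟩, hδ', hR'⟩ := hν
  obtain ⟨a, ha, hψ⟩ : (speedsSetoid b.I).r ψ ψ' := Quotient.exact (hδ.trans hδ'.symm)
  obtain ⟨ψ₀, hδ₀, s, hs⟩ : (formsSetoid b.δ b.W).r R R' := Quotient.exact (hR.trans hR'.symm)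
  obtain ⟨a₀, -, hψ₀⟩ : (speedsSetoid b.I).r ψ ψ₀ := Quotient.exact (hδ.trans hδ₀.symm)
  have hlim := hgf.tendsto_rho hhf ψ (a₀ * s) fun k x => by
    rw [hs, hψ₀, ← mul_assoc, ← Real.exp_add]
    convert one_mul _
    rw [Real.exp_eq_one_iff]
    ring
  have hsh : Tendsto (fun t : ℝ => a⁻¹ * (t - a₀ * s)) atTop atTop :=
    (tendsto_atTop_add_const_right _ _ tendsto_id).const_mul_atTop (inv_pos.2 ha)
  refine nullAsymptotic_of_tendsto hsh (hlim.congr fun t => ?_)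
  rw [hg, hh]
  congr 1
  simp only [expCurve]
  congr 3
  ext i
  rw [hψ]
  congr 1
  field_simp

/-! ### Spectral subspaces along a geodesic -/

/-- Comparison of the coefficients of two diagonalizations of one quadratic form. -/
theorem coeff_le_of_sum_eq {A B : Matrix (Fin n) (Fin n) ℝ} (hA : IsUnit A) (hB : IsUnit B)
    {a b : Fin n → ℝ} (ha : Antitone a) (hb : Antitone b) (hb0 : ∀ i, 0 ≤ b i) {K : ℝ}
    (hK : ∀ v, ∑ i, (B *ᵥ v) i ^ 2 ≤ K * ∑ i, (A *ᵥ v) i ^ 2)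
    (h : ∀ v, ∑ i, a i * (A *ᵥ v) i ^ 2 = ∑ i, b i * (B *ᵥ v) i ^ 2) (d : Fin n) :
    a d ≤ K * b d := by
  -- Courant–Fischer argument: `(n - 1 - d) + d = n - 1` linear conditions leave a nonzero `v`, on
  -- which the first form is at least `a d` and the second at most `b d` times the respective sum of
  -- squares.
  obtain ⟨v, hv, hvA, hvB⟩ := exists_ne_zero_of_card_lt A B (fun i => d < i) (fun i => i < d) hA hB (by
    rw [Finset.filter_lt_eq_Ioi, Finset.filter_gt_eq_Iio, Fin.card_Ioi, Fin.card_Iio]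
    have := d.2
    omega)
  have h1 : a d * ∑ i, (A *ᵥ v) i ^ 2 ≤ ∑ i, a i * (A *ᵥ v) i ^ 2 := by
    rw [Finset.mul_sum]
    refine Finset.sum_le_sum fun i _ => ?_
    rcases lt_or_ge d i with hi | hi
    · rw [hvA i hi]
      simp
    · exact mul_le_mul_of_nonneg_right (ha hi) (sq_nonneg _)
  have h2 : ∑ i, b i * (B *ᵥ v) i ^ 2 ≤ b d * ∑ i, (B *ᵥ v) i ^ 2 := by
    rw [Finset.mul_sum]
    refine Finset.sum_le_sum fun i _ => ?_
    rcases lt_or_ge i d with hi | hi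
    · rw [hvB i hi]
      simp
    · exact mul_le_mul_of_nonneg_right (hb hi) (sq_nonneg _)
  have h3 : 0 < ∑ i, (A *ᵥ v) i ^ 2 := by
    have hne : A *ᵥ v ≠ 0 := by
      intro h0
      refine hv (Matrix.mulVec_injective_iff_isUnit.2 hA ?_)
      simpa using h0
    obtain ⟨i, hi⟩ := Function.ne_iff.1 hne
    exact Finset.sum_pos' (fun _ _ => sq_nonneg _) ⟨i, Finset.mem_univ _, by
      have : (A *ᵥ v) i ≠ 0 := hi
      positivity⟩
  have h4 := mul_le_mul_of_nonneg_left (hK v) (hb0 d)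
  have h5 := h v
  refine le_of_mul_le_mul_right ?_ h3
  linarith

theorem sum_mulVec_sq_le (M : Matrix (Fin n) (Fin n) ℝ) (v : Fin n → ℝ) :
    ∑ i, (M *ᵥ v) i ^ 2 ≤ (∑ i, ∑ j, M i j ^ 2) * ∑ i, v i ^ 2 := by
  rw [Finset.sum_mul]
  refine Finset.sum_le_sum fun i _ => ?_
  rw [Matrix.mulVec, dotProduct]
  exact Finset.sum_mul_sq_le_sq_mul_sq _ _ _

theorem sum_mulVec_sq_of_orthogonal {U : Matrix (Fin n) (Fin n) ℝ} (hU : U * Uᵀ = 1) (v : Fin n → ℝ) :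
    ∑ i, (Uᵀ *ᵥ v) i ^ 2 = ∑ i, v i ^ 2 := by
  have h : (Uᵀ *ᵥ v) ⬝ᵥ (Uᵀ *ᵥ v) = v ⬝ᵥ v := by
    rw [Matrix.dotProduct_mulVec, ← Matrix.mulVec_transpose, Matrix.transpose_transpose,
      Matrix.mulVec_mulVec, hU, Matrix.one_mulVec]
  simpa [dotProduct, sq] using h

theorem abs_le_one_of_orthogonal {U : Matrix (Fin n) (Fin n) ℝ} (hU : U * Uᵀ = 1) (i j : Fin n) :
    |U i j| ≤ 1 :=
  entry_norm_bound_of_unitary (𝕜 := ℝ) ((Matrix.mem_orthogonalGroup_iff _ _).2 hU) i j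

theorem abs_mul_orthogonal_le {U : Matrix (Fin n) (Fin n) ℝ} (hU : U * Uᵀ = 1)
    (M : Matrix (Fin n) (Fin n) ℝ) (i j : Fin n) : |(M * U) i j| ≤ ∑ i, ∑ k, |M i k| := by
  have h1 : |(M * U) i j| ≤ ∑ k, |M i k| := by
    rw [Matrix.mul_apply]
    refine (Finset.abs_sum_le_sum_abs _ _).trans (Finset.sum_le_sum fun k _ => ?_)
    rw [abs_mul]
    exact mul_le_of_le_one_right (abs_nonneg _) (abs_le_one_of_orthogonal hU k j)
  exact h1.trans (Finset.single_le_sum (f := fun i => ∑ k, |M i k|)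
    (fun _ _ => Finset.sum_nonneg fun _ _ => abs_nonneg _) (Finset.mem_univ i))

/-- Uniform control of the spectral decompositions along a geodesic. -/
theorem exists_spectral_bound (g : GL (Fin n) ℝ) {φ : Fin n → ℝ} (hφ : Antitone φ) :
    ∃ K : ℝ, 0 < K ∧ ∀ t : ℝ, 0 ≤ t → ∀ (U : Matrix (Fin n) (Fin n) ℝ) (l : Fin n → ℝ), Antitone l →
      (∀ i, 0 < l i) → Uᵀ * U = 1 → U * Uᵀ = 1 → expCurve g φ t = U * Matrix.diagonal l * Uᵀ →
      (∀ d, l d ≤ K * Real.exp (φ d * t)) ∧ (∀ d, Real.exp (φ d * t) ≤ K * l d) ∧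
      ∀ i j, |((g : Matrix (Fin n) (Fin n) ℝ)ᵀ * U) i j| ≤ K * Real.exp ((φ j - φ i) * t) := by
  set G : Matrix (Fin n) (Fin n) ℝ := g.1 with hG
  set K₁ : ℝ := ∑ i, ∑ j, (Gᵀ) i j ^ 2 with hK₁
  set K₂ : ℝ := ∑ i, ∑ j, (G⁻¹ᵀ) i j ^ 2 with hK₂
  set K₃ : ℝ := ∑ i, ∑ j, |G⁻¹ i j| with hK₃
  have p1 : 0 ≤ K₁ := by positivity
  have p2 : 0 ≤ K₂ := by positivity
  have p3 : 0 ≤ K₃ := by positivity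
  refine ⟨K₁ + K₂ + K₃ * K₁ + 1, by positivity, fun t ht U l hl hl0 hU1 hU2 hX => ?_⟩
  have hsum : ∀ v, ∑ i, l i * (Uᵀ *ᵥ v) i ^ 2 = ∑ i, Real.exp (φ i * t) * (Gᵀ *ᵥ v) i ^ 2 := by
    intro v
    have h1 := quadForm_expCurve g φ t v
    rw [hX, quadForm_conj, quadForm_diagonal] at h1
    linarith
  have hUu : IsUnit Uᵀ := ⟨⟨Uᵀ, U, hU1, hU2⟩, rfl⟩
  have hexp : Antitone fun i => Real.exp (φ i * t) := fun i j hij =>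
    Real.exp_le_exp.2 (mul_le_mul_of_nonneg_right (hφ hij) ht)
  have b1 : ∀ d, l d ≤ K₁ * Real.exp (φ d * t) := by
    refine coeff_le_of_sum_eq hUu (isUnit_transpose g) hl hexp (fun i => (Real.exp_pos _).le)
      (fun v => ?_) hsum
    rw [sum_mulVec_sq_of_orthogonal hU2]
    exact sum_mulVec_sq_le Gᵀ v
  have b2 : ∀ d, Real.exp (φ d * t) ≤ K₂ * l d := by
    refine coeff_le_of_sum_eq (isUnit_transpose g) hUu hexp hl (fun i => (hl0 i).le)
      (fun v => ?_) fun v => (hsum v).symm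
    rw [sum_mulVec_sq_of_orthogonal hU2]
    have h1 := sum_mulVec_sq_le G⁻¹ᵀ (Gᵀ *ᵥ v)
    rwa [Matrix.mulVec_mulVec, hG, gl_transpose_inv_mul, Matrix.one_mulVec] at h1
  have b3 : ∀ i j, |(Gᵀ * U) i j| ≤ K₃ * K₁ * Real.exp ((φ j - φ i) * t) := by
    intro i j
    -- Two factorizations of `G⁻¹ μ(t) U`. Entrywise this gives `(Gᵀ U)_{ij} = e^{-φ_i t} (G⁻¹
    -- U)_{ij} l_j`, where `G⁻¹ U` is bounded because `U` is orthogonal.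
    have e : Matrix.diagonal (fun i => Real.exp (φ i * t)) * (Gᵀ * U) =
        G⁻¹ * U * Matrix.diagonal l := by
      have h1 := congrArg (fun M => G⁻¹ * (M * U)) hX
      simp only [expCurve, Matrix.mul_assoc, hU1, Matrix.mul_one] at h1
      rw [← Matrix.mul_assoc G⁻¹, ← Matrix.mul_assoc G⁻¹ U, hG, gl_inv_mul, Matrix.one_mul] at h1
      exact h1
    have e1 := congrFun (congrFun e i) j
    rw [Matrix.diagonal_mul, Matrix.mul_diagonal] at e1
    have e2 : |(Gᵀ * U) i j| = Real.exp (-(φ i * t)) * (|(G⁻¹ * U) i j| * l j) := by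
      rw [← abs_of_pos (hl0 j), ← abs_mul, ← e1, abs_mul, abs_of_pos (Real.exp_pos _), ← mul_assoc,
        ← Real.exp_add, neg_add_cancel, Real.exp_zero, one_mul]
    rw [e2]
    calc Real.exp (-(φ i * t)) * (|(G⁻¹ * U) i j| * l j)
        ≤ Real.exp (-(φ i * t)) * (K₃ * (K₁ * Real.exp (φ j * t))) := by
          gcongr
          · exact (hl0 j).le
          · exact abs_mul_orthogonal_le hU2 _ i j
          · exact b1 j
      _ = K₃ * K₁ * Real.exp ((φ j - φ i) * t) := by
          rw [sub_mul, sub_eq_add_neg, Real.exp_add]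
          ring
  refine ⟨fun d => (b1 d).trans ?_, fun d => (b2 d).trans ?_, fun i j => (b3 i j).trans ?_⟩
  · exact mul_le_mul_of_nonneg_right (by nlinarith) (Real.exp_pos _).le
  · exact mul_le_mul_of_nonneg_right (by nlinarith) (hl0 d).le
  · exact mul_le_mul_of_nonneg_right (by nlinarith) (Real.exp_pos _).le

/-- The tail of the spectrum, in terms of a sorted spectral decomposition with a gap. -/
theorem spectralTail_eq {U : Matrix (Fin n) (Fin n) ℝ} {l : Fin n → ℝ} (hl : Antitone l)
    (hU1 : Uᵀ * U = 1) (hU2 : U * Uᵀ = 1) {d : ℕ} (hd : d ≤ n)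
    (hgap : ∀ i j : Fin n, (i : ℕ) < d → d ≤ (j : ℕ) → l j < l i) :
    spectralTail (U * Matrix.diagonal l * Uᵀ) d = coordKer Uᵀ fun i => (i : ℕ) < d := by
  set X := U * Matrix.diagonal l * Uᵀ with hX
  have hroots : X.charpoly.roots = Finset.univ.val.map l := by
    have : X.charpoly = (Matrix.diagonal l).charpoly := by
      rw [hX, Matrix.mul_assoc, Matrix.charpoly_mul_comm, Matrix.mul_assoc, hU1, Matrix.mul_one]
    rw [this, Matrix.charpoly_diagonal]
    exact Polynomial.roots_multiset_prod_X_sub_C (Finset.univ.val.map l) ▸ by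
      rw [Multiset.map_map]; rfl
  have hcount : ∀ r : ℝ, (X.charpoly.roots.filter fun l' => r < l').card =
      (Finset.univ.filter fun i => r < l i).card := by
    intro r
    rw [hroots, Multiset.filter_map, Multiset.card_map]
    rfl
  have hXU : ∀ v, Uᵀ *ᵥ (X *ᵥ v) = Matrix.diagonal l *ᵥ (Uᵀ *ᵥ v) := by
    intro v
    rw [hX, Matrix.mulVec_mulVec, Matrix.mulVec_mulVec, ← Matrix.mul_assoc, ← Matrix.mul_assoc, hU1,
      Matrix.one_mul]
  refine le_antisymm (Submodule.span_le.2 ?_) ?_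
  · rintro v ⟨r, hv, hr⟩ j hj
    by_contra hne
    have h1 := congrFun (hXU v) j
    rw [hv, Matrix.mulVec_smul, Matrix.mulVec_diagonal, Pi.smul_apply, smul_eq_mul] at h1
    have hrl : r = l j := mul_right_cancel₀ hne h1
    rw [hcount] at hr
    -- A nonzero coordinate at `j < d` makes the eigenvalue equal to `l j`, above which there are at
    -- most `j` eigenvalues, fewer than `d`.
    have hsub : (Finset.univ.filter fun i => r < l i) ⊆ Finset.univ.filter fun i => i < j := by
      intro i hi
      simp only [Finset.mem_filter, Finset.mem_univ, true_and] at hi ⊢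
      by_contra! hji
      exact not_le.2 hi (hrl ▸ hl hji)
    have h2 := Finset.card_le_card hsub
    rw [Finset.filter_gt_eq_Iio, Fin.card_Iio] at h2
    omega
  · intro v hv
    have hexp : v = ∑ j, (Uᵀ *ᵥ v) j • (U *ᵥ Pi.single j 1) := by
      conv_lhs => rw [← Matrix.one_mulVec v, ← hU2, ← Matrix.mulVec_mulVec]
      conv_lhs => rw [pi_eq_sum_univ' (Uᵀ *ᵥ v), Matrix.mulVec_sum]
      refine Finset.sum_congr rfl fun j _ => ?_
      rw [← Matrix.mulVec_smul]
    rw [hexp]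
    refine Submodule.sum_mem _ fun j _ => ?_
    rcases lt_or_ge (j : ℕ) d with hj | hj
    · rw [hv j hj, zero_smul]
      exact Submodule.zero_mem _
    · refine Submodule.smul_mem _ _ (Submodule.subset_span ⟨l j, ?_, ?_⟩)
      · rw [hX, Matrix.mulVec_mulVec, Matrix.mul_assoc, hU1, Matrix.mul_one, ← Matrix.mulVec_mulVec,
          ← Matrix.mulVec_smul]
        congr 1
        ext i
        rw [Matrix.mulVec_diagonal]
        by_cases hij : i = j
        · subst hij; simp
        · simp [hij]
      · rw [hcount]
        have hsub : (Finset.univ.filter fun i : Fin n => (i : ℕ) < d) ⊆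
            Finset.univ.filter fun i => l j < l i := by
          intro i hi
          simp only [Finset.mem_filter, Finset.mem_univ, true_and] at hi ⊢
          exact hgap i j hi hj
        have h2 := Finset.card_le_card hsub
        rw [Fin.card_filter_val_lt, min_eq_right hd] at h2
        exact h2

/-- Sorted spectral decompositions along a geodesic, and the spectral tails at the block ends. -/
theorem exists_spectral_family (g : GL (Fin n) ℝ) {I : CompositionAsSet n} (ψ : Speeds I) :
    ∃ (U : ℝ → Matrix (Fin n) (Fin n) ℝ) (K : ℝ), 0 < K ∧ (∀ t, (U t)ᵀ * U t = 1) ∧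
      (∀ t, U t * (U t)ᵀ = 1) ∧
      (∀ t, 0 ≤ t → ∀ i j, |((g : Matrix (Fin n) (Fin n) ℝ)ᵀ * U t) i j| ≤
        K * Real.exp ((ψ.1 (blk I j) - ψ.1 (blk I i)) * t)) ∧
      ∀ k : Fin (I.length + 1), ∀ᶠ t in atTop,
        spectralTail (expCurve g (fun i => ψ.1 (blk I i)) t) (cut I k) =
          coordKer (U t)ᵀ fun i => (blk I i).castSucc < k := by
  set φ : Fin n → ℝ := fun i => ψ.1 (blk I i) with hφ
  have hanti : Antitone φ := fun i j hij => ψ.2.1.antitone (blk_mono I hij)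
  obtain ⟨K, hK, hbound⟩ := exists_spectral_bound g hanti
  choose U l hl hl0 hU1 hU2 hX using fun t => exists_sorted_spectral_posDef (posDef_expCurve g φ t)
  refine ⟨U, K, hK, hU1, hU2, fun t ht => (hbound t ht _ _ (hl t) (hl0 t) (hU1 t) (hU2 t) (hX t)).2.2,
    fun k => ?_⟩
  -- Two-sided comparison with `e^{φ t}` costs a factor `K²`, which the exponential separation of
  -- distinct speeds eventually beats.
  have hgap : ∀ᶠ t in atTop, ∀ i j : Fin n, blk I i < blk I j → l t j < l t i := by
    simp only [eventually_all]
    intro i j hij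
    have hneg : φ j - φ i < 0 := sub_neg.2 (ψ.2.1 hij)
    have h1 := ((tendsto_exp_neg_mul tendsto_id hneg).const_mul (K * K))
    rw [mul_zero] at h1
    filter_upwards [h1.eventually_lt_const one_pos, eventually_ge_atTop 0] with t ht ht0
    obtain ⟨b1, b2, -⟩ := hbound t ht0 _ _ (hl t) (hl0 t) (hU1 t) (hU2 t) (hX t)
    have h2 : K * l t j ≤ K * K * Real.exp ((φ j - φ i) * t) * Real.exp (φ i * t) := by
      rw [mul_assoc (K * K), ← Real.exp_add, mul_assoc K K]
      refine mul_le_mul_of_nonneg_left ((b1 j).trans (le_of_eq ?_)) hK.le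
      congr 2
      ring
    have h3 : K * l t j < K * l t i := by
      refine (h2.trans_lt ?_).trans_le (b2 i)
      exact mul_lt_of_lt_one_left (Real.exp_pos _) ht
    exact lt_of_mul_lt_mul_left h3 hK.le
  filter_upwards [hgap] with t ht
  rw [hX t, spectralTail_eq (hl t) (hU1 t) (hU2 t) (Fin.is_le _) fun i j hi hj => ht i j ?_]
  · simp only [lt_cut_iff]
  · rw [lt_cut_iff] at hi
    rw [← not_lt, lt_cut_iff, not_lt] at hj
    exact Fin.castSucc_lt_castSucc_iff.1 (hi.trans_le hj)

/-- Vectors in the spectral tails have small leading coordinates. -/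
theorem exists_spectralTail_bound (g : GL (Fin n) ℝ) {I : CompositionAsSet n} (ψ : Speeds I)
    (k : Fin I.length) :
    ∃ K : ℝ, ∀ᶠ t in atTop, ∀ v ∈ spectralTail (expCurve g (fun i => ψ.1 (blk I i)) t)
        (cut I k.castSucc), ∀ i, blk I i < k →
      |((g : Matrix (Fin n) (Fin n) ℝ)ᵀ *ᵥ v) i| ≤
        K * (∑ m, |v m|) * Real.exp ((ψ.1 k - ψ.1 (blk I i)) * t) := by
  obtain ⟨U, K, hK, hU1, hU2, hb, htail⟩ := exists_spectral_family g ψ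
  refine ⟨n * K, ?_⟩
  filter_upwards [htail k.castSucc, eventually_ge_atTop 0] with t ht ht0 v hv i hi
  rw [ht] at hv
  have e : (g : Matrix (Fin n) (Fin n) ℝ)ᵀ *ᵥ v =
      ((g : Matrix (Fin n) (Fin n) ℝ)ᵀ * U t) *ᵥ ((U t)ᵀ *ᵥ v) := by
    rw [Matrix.mulVec_mulVec, Matrix.mul_assoc, hU2, Matrix.mul_one]
  have hc : ∀ j, |((U t)ᵀ *ᵥ v) j| ≤ ∑ m, |v m| := by
    intro j
    rw [Matrix.mulVec, dotProduct]
    refine (Finset.abs_sum_le_sum_abs _ _).trans (Finset.sum_le_sum fun m _ => ?_)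
    rw [abs_mul]
    exact mul_le_of_le_one_left (abs_nonneg _) (abs_le_one_of_orthogonal (hU2 t) m j)
  rw [e, Matrix.mulVec, dotProduct]
  refine (Finset.abs_sum_le_sum_abs _ _).trans ?_
  have hterm : ∀ j, |((g : Matrix (Fin n) (Fin n) ℝ)ᵀ * U t) i j * ((U t)ᵀ *ᵥ v) j| ≤
      K * (∑ m, |v m|) * Real.exp ((ψ.1 k - ψ.1 (blk I i)) * t) := by
    intro j
    rcases lt_or_ge (blk I j) k with hj | hj
    · rw [hv j (Fin.castSucc_lt_castSucc_iff.2 hj), mul_zero, abs_zero]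
      positivity
    · rw [abs_mul]
      calc |((g : Matrix (Fin n) (Fin n) ℝ)ᵀ * U t) i j| * |((U t)ᵀ *ᵥ v) j|
          ≤ (K * Real.exp ((ψ.1 (blk I j) - ψ.1 (blk I i)) * t)) * ∑ m, |v m| :=
            mul_le_mul (hb t ht0 i j) (hc j) (abs_nonneg _) (by positivity)
        _ ≤ (K * Real.exp ((ψ.1 k - ψ.1 (blk I i)) * t)) * ∑ m, |v m| := by
            have := ψ.2.1.antitone hj
            gcongr
        _ = _ := by ring
  refine (Finset.sum_le_sum fun j _ => hterm j).trans (le_of_eq ?_)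
  simp
  ring

/-- Limits of vectors in the spectral tails lie in the flag, and the rescaled quadratic forms
converge along them. -/
theorem tendsto_of_mem_spectralTail (g : GL (Fin n) ℝ) {I : CompositionAsSet n} (ψ : Speeds I)
    (k : Fin I.length) {v : ℝ → Fin n → ℝ} {w : Fin n → ℝ} (hv : Tendsto v atTop (𝓝 w))
    (hmem : ∀ᶠ t in atTop, v t ∈ spectralTail (expCurve g (fun i => ψ.1 (blk I i)) t)
      (cut I k.castSucc)) :
    (∀ i, blk I i < k → ((g : Matrix (Fin n) (Fin n) ℝ)ᵀ *ᵥ w) i = 0) ∧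
    Tendsto (fun t => Real.exp (-(ψ.1 k * t)) *
        quadForm (expCurve g (fun i => ψ.1 (blk I i)) t) (v t)) atTop
      (𝓝 (1 / 2 * ∑ i, if blk I i = k then ((g : Matrix (Fin n) (Fin n) ℝ)ᵀ *ᵥ w) i ^ 2 else 0)) := by
  obtain ⟨K, hK⟩ := exists_spectralTail_bound g ψ k
  have hx : Tendsto (fun t => (g : Matrix (Fin n) (Fin n) ℝ)ᵀ *ᵥ v t) atTop
      (𝓝 ((g : Matrix (Fin n) (Fin n) ℝ)ᵀ *ᵥ w)) :=
    ((continuous_const.matrix_mulVec continuous_id).tendsto w).comp hv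
  have hS : Tendsto (fun t => K * ∑ m, |v t m|) atTop (𝓝 (K * ∑ m, |w m|)) :=
    (tendsto_finsetSum _ fun m _ => (tendsto_pi_nhds.1 hv m).abs).const_mul K
  have hbd : ∀ᶠ t in atTop, ∀ i, blk I i < k → |((g : Matrix (Fin n) (Fin n) ℝ)ᵀ *ᵥ v t) i| ≤
      K * (∑ m, |v t m|) * Real.exp ((ψ.1 k - ψ.1 (blk I i)) * t) := by
    filter_upwards [hK, hmem] with t h1 h2
    exact h1 _ h2
  have hneg : ∀ i, blk I i < k → ψ.1 k - ψ.1 (blk I i) < 0 := fun i hi => sub_neg.2 (ψ.2.1 hi)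
  constructor
  · intro i hi
    have h1 := hS.mul (tendsto_exp_neg_mul tendsto_id (hneg i hi))
    rw [mul_zero] at h1
    refine tendsto_nhds_unique (tendsto_pi_nhds.1 hx i) (squeeze_zero_norm' ?_ h1)
    filter_upwards [hbd] with t ht
    exact ht i hi
  · simp only [quadForm_expCurve]
    refine tendsto_rescaled_sum tendsto_id ψ k hx fun i hi => ?_
    -- A squared coordinate contributes `e^{2(ψ_k - ψ_i)t}`, with `ψ_i` the speed of the block of
    -- `i`, against the growth `e^{(ψ_i - ψ_k)t}`; one decaying factor remains.
    have h1 := (hS.pow 2).mul (tendsto_exp_neg_mul tendsto_id (hneg i hi))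
    rw [mul_zero] at h1
    refine squeeze_zero' (Eventually.of_forall fun t => by positivity) ?_ h1
    filter_upwards [hbd] with t ht
    simp only [id]
    have h2 := pow_le_pow_left₀ (abs_nonneg _) (ht i hi) 2
    rw [sq_abs, mul_pow, sq (Real.exp _), ← Real.exp_add] at h2
    refine (mul_le_mul_of_nonneg_left h2 (Real.exp_pos _).le).trans (le_of_eq ?_)
    rw [mul_left_comm, ← Real.exp_add]
    congr 2
    ring

/-! ### Equivalence of spectral limit data and frames -/

theorem tendsto_matrix_mulVec {α : Type*} {l : Filter α} {f : α → Matrix (Fin n) (Fin n) ℝ}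
    {A : Matrix (Fin n) (Fin n) ℝ} (h : Tendsto f l (𝓝 A)) (v : Fin n → ℝ) :
    Tendsto (fun a => f a *ᵥ v) l (𝓝 (A *ᵥ v)) :=
  ((continuous_id.matrix_mulVec continuous_const).tendsto A).comp h

theorem orthogonal_mul_inv (h : Matrix.orthogonalGroup (Fin n) ℝ) :
    (h : Matrix (Fin n) (Fin n) ℝ)⁻¹ * (h : Matrix (Fin n) (Fin n) ℝ) = 1 := by
  have h1 := (Matrix.mem_orthogonalGroup_iff' _ _).1 h.2
  rw [Matrix.inv_eq_left_inv h1, h1]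

theorem tendsto_orthogonal_inv_mulVec {h : ℝ → Matrix.orthogonalGroup (Fin n) ℝ}
    (hh : Tendsto (fun t => (h t : Matrix (Fin n) (Fin n) ℝ)) atTop (𝓝 1)) (w : Fin n → ℝ) :
    Tendsto (fun t => (h t : Matrix (Fin n) (Fin n) ℝ)⁻¹ *ᵥ w) atTop (𝓝 w) := by
  have h1 := tendsto_matrix_mulVec (tendsto_inv isUnit_one hh) w
  rwa [inv_one, Matrix.one_mulVec] at h1

theorem orthogonal_inv_mulVec_mem {h : Matrix.orthogonalGroup (Fin n) ℝ}
    {V W : Submodule ℝ (Fin n → ℝ)}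
    (hVW : V.map (Matrix.toLin' (h : Matrix (Fin n) (Fin n) ℝ)) = W) {w : Fin n → ℝ} (hw : w ∈ W) :
    (h : Matrix (Fin n) (Fin n) ℝ)⁻¹ *ᵥ w ∈ V := by
  rw [← hVW] at hw
  obtain ⟨u, hu, rfl⟩ := hw
  rw [Matrix.toLin'_apply, Matrix.mulVec_mulVec, orthogonal_mul_inv, Matrix.one_mulVec]
  exact hu

/-- For `v` in `W_k` the vectors `h(t)⁻¹ v` lie in the spectral subspaces and tend to `v`. So `W_k`
is contained in the flag term of `g`, with equality by dimension, and uniqueness of limits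
identifies the forms. -/
theorem HasLimitData.isModel {μ : ParamGeodesic n} {I : CompositionAsSet n} {ψ : Speeds I}
    {W : Flag I} {R : Forms W} (hμ : HasLimitData μ ψ W R) : IsModel μ ψ W R := by
  obtain ⟨hvel, hlim⟩ := hμ
  obtain ⟨g, hg⟩ := (hasVelocity_iff μ I ψ).1 hvel
  rw [hg] at hlim
  obtain ⟨W', hW'⟩ := exists_flag I g
  have key : ∀ (k : Fin I.length) (v : W.1 k.castSucc),
      (∀ i, blk I i < k → ((g : Matrix (Fin n) (Fin n) ℝ)ᵀ *ᵥ (v : Fin n → ℝ)) i = 0) ∧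
      (R k).1 (Submodule.Quotient.mk v) = 1 / 2 * ∑ i, if blk I i = k then
        ((g : Matrix (Fin n) (Fin n) ℝ)ᵀ *ᵥ (v : Fin n → ℝ)) i ^ 2 else 0 := by
    intro k v
    obtain ⟨h, hh, hmap, hR⟩ := hlim k
    have h1 := tendsto_of_mem_spectralTail g ψ k (tendsto_orthogonal_inv_mulVec hh v) (by
      filter_upwards [hmap] with t ht
      exact orthogonal_inv_mulVec_mem ht v.2)
    exact ⟨h1.1, tendsto_nhds_unique (hR v) h1.2⟩
  refine ⟨g, hg, fun k => ?_, fun k v => (key k v).2⟩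
  have hWW : W.1 k = W'.1 k := by
    refine Submodule.eq_of_le_of_finrank_eq ?_ (by have := W.2.2 k; have := W'.2.2 k; omega)
    induction k using Fin.lastCases with
    | last => rw [W.last_eq_bot]; exact bot_le
    | cast k =>
      intro v hv
      rw [hW']
      exact fun i hi => (key k ⟨v, hv⟩).1 i (Fin.castSucc_lt_castSucc_iff.1 hi)
  rw [hWW]
  exact hW' k

/-- Convergent families of subspaces are identified with their limit by orthogonal operators
tending to the identity. -/
theorem exists_orthogonal_tendsto_one {U : ℝ → Matrix (Fin n) (Fin n) ℝ} (hU1 : ∀ t, (U t)ᵀ * U t = 1)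
    (hU2 : ∀ t, U t * (U t)ᵀ = 1) (g : GL (Fin n) ℝ) (p : Fin n → Prop)
    (hoff : ∀ i j, p i → ¬ p j →
      Tendsto (fun t => ((g : Matrix (Fin n) (Fin n) ℝ)ᵀ * U t) i j) atTop (𝓝 0)) :
    ∃ h : ℝ → Matrix.orthogonalGroup (Fin n) ℝ,
      Tendsto (fun t => (h t : Matrix (Fin n) (Fin n) ℝ)) atTop (𝓝 1) ∧
      ∀ t, (coordKer (U t)ᵀ p).map (Matrix.toLin' (h t : Matrix (Fin n) (Fin n) ℝ)) =
        coordKer (g : Matrix (Fin n) (Fin n) ℝ)ᵀ p := by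
  classical
  set P : ℝ → Matrix.orthogonalGroup (Fin n) ℝ → Prop := fun t h =>
    (coordKer (U t)ᵀ p).map (Matrix.toLin' (h : Matrix (Fin n) (Fin n) ℝ)) =
      coordKer (g : Matrix (Fin n) (Fin n) ℝ)ᵀ p with hP
  -- The eigenbases `U t` need not converge, but along an ultrafilter they tend to an orthogonal `V`
  -- adapted to the limit flag, and `V (U t)ᵀ` is a good identification along that ultrafilter.
  have hcluster : ∀ F : Ultrafilter ℝ, ↑F ≤ (atTop : Filter ℝ) →
      ∃ h : ℝ → Matrix.orthogonalGroup (Fin n) ℝ, (∀ t, P t (h t)) ∧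
        Tendsto (fun t => (h t : Matrix (Fin n) (Fin n) ℝ)) F (𝓝 1) := by
    intro F hF
    have hcpt : IsCompact (Set.univ.pi fun _ : Fin n => Set.univ.pi fun _ : Fin n =>
        Set.Icc (-1 : ℝ) 1) := isCompact_univ_pi fun _ => isCompact_univ_pi fun _ => isCompact_Icc
    obtain ⟨V, -, hV⟩ := isCompact_iff_ultrafilter_le_nhds.1 hcpt (F.map U) (by
      refine le_principal_iff.2 (Filter.mem_map.2 (Filter.univ_mem' fun t => ?_))
      exact fun i _ j _ => abs_le.1 (abs_le_one_of_orthogonal (hU2 t) i j))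
    have hV : Tendsto U F (𝓝 (V : Matrix (Fin n) (Fin n) ℝ)) := hV
    change Matrix (Fin n) (Fin n) ℝ at V
    have hVt : Tendsto (fun t => (U t)ᵀ) F (𝓝 Vᵀ) :=
      ((continuous_id.matrix_transpose).tendsto V).comp hV
    have hV1 : Vᵀ * V = 1 := tendsto_nhds_unique (hVt.mul hV) (by simp [hU1])
    have hV2 : V * Vᵀ = 1 := tendsto_nhds_unique (hV.mul hVt) (by simp [hU2])
    have hlim : Tendsto (fun t => V * (U t)ᵀ) F (𝓝 1) := by
      rw [← hV2]
      exact hVt.const_mul V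
    have hzero : ∀ i j, p i → ¬ p j → ((g : Matrix (Fin n) (Fin n) ℝ)ᵀ * V) i j = 0 := by
      intro i j hi hj
      exact tendsto_nhds_unique (tendsto_matrix_iff.1 (hV.const_mul _) i j) ((hoff i j hi hj).mono_left hF)
    have horth : ∀ t, V * (U t)ᵀ ∈ Matrix.orthogonalGroup (Fin n) ℝ := by
      intro t
      rw [Matrix.mem_orthogonalGroup_iff, Matrix.transpose_mul, Matrix.transpose_transpose,
        Matrix.mul_assoc, ← Matrix.mul_assoc _ (U t), hU1, Matrix.one_mul, hV2]
    refine ⟨fun t => ⟨V * (U t)ᵀ, horth t⟩, fun t => ?_, hlim⟩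
    have hinj : Function.Injective (Matrix.toLin' (V * (U t)ᵀ)) := by
      intro v w hvw
      have h1 := congrArg ((V * (U t)ᵀ)ᵀ *ᵥ ·) hvw
      simpa only [Matrix.toLin'_apply, Matrix.mulVec_mulVec,
        (Matrix.mem_orthogonalGroup_iff' _ _).1 (horth t), Matrix.one_mulVec] using h1
    have hUu : IsUnit (U t)ᵀ := ⟨⟨(U t)ᵀ, U t, hU1 t, hU2 t⟩, rfl⟩
    refine Submodule.eq_of_le_of_finrank_eq ?_ ?_
    · rintro _ ⟨v, hv, rfl⟩ i hi
      rw [Matrix.toLin'_apply, ← Matrix.mulVec_mulVec, Matrix.mulVec_mulVec, Matrix.mulVec, dotProduct]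
      refine Finset.sum_eq_zero fun j _ => ?_
      by_cases hj : p j
      · rw [hv j hj, mul_zero]
      · rw [hzero i j hi hj, zero_mul]
    · rw [← LinearEquiv.finrank_eq (Submodule.equivMapOfInjective _ hinj (coordKer (U t)ᵀ p))]
      have h1 := finrank_coordKer hUu p
      have h2 := finrank_coordKer (isUnit_transpose g) p
      omega
  let D (h : Matrix.orthogonalGroup (Fin n) ℝ) : ℝ :=
    ∑ i, ∑ j, ((h : Matrix (Fin n) (Fin n) ℝ) i j - (1 : Matrix (Fin n) (Fin n) ℝ) i j) ^ 2
  have hD0 : ∀ h, 0 ≤ D h := fun h => Finset.sum_nonneg fun _ _ => Finset.sum_nonneg fun _ _ => sq_nonneg _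
  -- An almost closest identification to `1` is chosen independently of ultrafilters. It is nearly
  -- as good as each of the local choices above, so it tends to `1` along all ultrafilters; the
  -- slack `e^{-t}` makes attainment of the minimum unnecessary.
  have hmin : ∀ t, ∃ h, P t h ∧ ∀ h', P t h' → D h ≤ D h' + Real.exp (-t) := by
    intro t
    obtain ⟨h₀, hh₀, -⟩ := hcluster (Ultrafilter.of atTop) (Ultrafilter.of_le _)
    obtain ⟨_, ⟨h, hh, rfl⟩, hlt⟩ := exists_lt_of_csInf_lt (s := D '' {h | P t h})
      ⟨_, h₀ t, hh₀ t, rfl⟩ (lt_add_of_pos_right _ (Real.exp_pos (-t)))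
    refine ⟨h, hh, fun h' hh' => hlt.le.trans ?_⟩
    gcongr
    refine csInf_le ⟨0, ?_⟩ ⟨h', hh', rfl⟩
    rintro _ ⟨h, -, rfl⟩
    exact hD0 h
  choose h hhP hhD using hmin
  refine ⟨h, ?_, hhP⟩
  have hDlim : Tendsto (fun t => D (h t)) atTop (𝓝 0) := by
    rw [tendsto_iff_ultrafilter]
    intro F hF
    obtain ⟨h', hh', hl⟩ := hcluster F hF
    have h1 : Tendsto (fun t => D (h' t) + Real.exp (-t)) F (𝓝 0) := by
      have h2 : Tendsto (fun t => D (h' t)) F (𝓝 0) := by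
        have : Tendsto (fun t => D (h' t)) F (𝓝 (∑ i : Fin n, ∑ j : Fin n,
            ((1 : Matrix (Fin n) (Fin n) ℝ) i j - (1 : Matrix (Fin n) (Fin n) ℝ) i j) ^ 2)) :=
          tendsto_finsetSum _ fun i _ => tendsto_finsetSum _ fun j _ =>
            ((tendsto_matrix_iff.1 hl i j).sub_const _).pow 2
        simpa using this
      simpa using h2.add (Real.tendsto_exp_neg_atTop_nhds_zero.mono_left hF)
    exact squeeze_zero (fun t => hD0 _) (fun t => hhD t _ (hh' t)) h1
  rw [tendsto_matrix_iff]
  intro i j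
  have hsq : Tendsto (fun t => √(D (h t))) atTop (𝓝 0) := by simpa using hDlim.sqrt
  rw [tendsto_iff_norm_sub_tendsto_zero]
  refine squeeze_zero (fun t => norm_nonneg _) (fun t => ?_) hsq
  rw [Real.norm_eq_abs]
  refine Real.abs_le_sqrt ?_
  exact (Finset.single_le_sum (f := fun j => ((h t : Matrix (Fin n) (Fin n) ℝ) i j -
      (1 : Matrix (Fin n) (Fin n) ℝ) i j) ^ 2) (fun _ _ => sq_nonneg _) (Finset.mem_univ j)).trans
    (Finset.single_le_sum (f := fun i => ∑ j, ((h t : Matrix (Fin n) (Fin n) ℝ) i j -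
      (1 : Matrix (Fin n) (Fin n) ℝ) i j) ^ 2)
      (fun _ _ => Finset.sum_nonneg fun _ _ => sq_nonneg _) (Finset.mem_univ i))

/-- Eigenvectors of the later blocks have decaying `g`-coordinates in the earlier ones, which is the
criterion for identifying the spectral subspaces with the flag by orthogonal operators tending to
`1`. -/
theorem IsModel.hasLimitData {μ : ParamGeodesic n} {I : CompositionAsSet n} {ψ : Speeds I}
    {W : Flag I} {R : Forms W} (hμ : IsModel μ ψ W R) : HasLimitData μ ψ W R := by
  obtain ⟨g, hg, hf⟩ := hμ
  refine ⟨(hasVelocity_iff μ I ψ).2 ⟨g, hg⟩, fun k => ?_⟩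
  obtain ⟨U, K, hK, hU1, hU2, hb, htail⟩ := exists_spectral_family g ψ
  obtain ⟨h, hh, hmap⟩ := exists_orthogonal_tendsto_one hU1 hU2 g
    (fun i => (blk I i).castSucc < k.castSucc) (by
      intro i j hi hj
      have hij : blk I i < blk I j :=
        Fin.castSucc_lt_castSucc_iff.1 (hi.trans_le (not_lt.1 hj))
      have h1 := (tendsto_exp_neg_mul tendsto_id (sub_neg.2 (ψ.2.1 hij))).const_mul K
      rw [mul_zero] at h1
      refine squeeze_zero_norm' ?_ h1
      filter_upwards [eventually_ge_atTop 0] with t ht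
      exact hb t ht i j)
  have hW : coordKer (g : Matrix (Fin n) (Fin n) ℝ)ᵀ (fun i => (blk I i).castSucc < k.castSucc) =
      W.1 k.castSucc := by
    ext v
    exact (hf.mem_iff _ v).symm
  have hmap' : ∀ᶠ t in atTop, (spectralTail (μ.toFun t) (cut I k.castSucc)).map
      (Matrix.toLin' (h t : Matrix (Fin n) (Fin n) ℝ)) = W.1 k.castSucc := by
    filter_upwards [htail k.castSucc] with t ht
    rw [hg, ht, hmap, hW]
  refine ⟨h, hh, hmap', fun v => ?_⟩
  rw [hf.form_eq, hg]
  refine (tendsto_of_mem_spectralTail g ψ k (tendsto_orthogonal_inv_mulVec hh v) ?_).2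
  filter_upwards [hmap'] with t ht
  rw [hg] at ht
  exact orthogonal_inv_mulVec_mem ht v.2

/-! ### The classification -/

theorem hasBoundaryData_iff {μ : ParamGeodesic n} {b : BoundaryData n} :
    HasBoundaryData μ b ↔ IsDatum μ b := by
  constructor
  · rintro ⟨ψ, R, h, hδ, hR⟩
    exact ⟨ψ, R, h.isModel, hδ, hR⟩
  · rintro ⟨ψ, R, h, hδ, hR⟩
    exact ⟨ψ, R, h.hasLimitData, hδ, hR⟩

theorem exists_isDatum (μ : ParamGeodesic n) : ∃ b, IsDatum μ b := by
  obtain ⟨g, φ, hφ, h0, hμ⟩ := μ.exists_eq_expCurve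
  obtain ⟨I, ψ, rfl⟩ := exists_speeds hφ h0
  obtain ⟨W, R, hf⟩ := exists_isFrame I g
  exact ⟨⟨I, ψ.toSimplex, W, Quotient.mk _ R⟩, ψ, R, ⟨g, hμ, hf⟩, rfl, rfl⟩

theorem exists_geodesic_of_datum (b : BoundaryData n) : ∃ μ, IsDatum μ b := by
  obtain ⟨ψ, hψ⟩ := Quotient.exists_rep b.δ
  obtain ⟨R, hR⟩ := Quotient.exists_rep b.R
  obtain ⟨g, hg⟩ := exists_frame b.W R
  -- A nonzero speed on a nonempty block ensures that the curve is not constant.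
  obtain ⟨k, hk⟩ := ψ.exists_ne_zero
  obtain ⟨i, hi⟩ := exists_blk_eq b.I k
  obtain ⟨μ, hμ⟩ := exists_paramGeodesic g (φ := fun i => ψ.1 (blk b.I i)) fun h0 =>
    hk (hi ▸ congrFun h0 i)
  exact ⟨μ, ψ, R, ⟨g, hμ, hg⟩, hψ, hR⟩

theorem nullAsymptotic_iff {μ ν : ParamGeodesic n} {b b' : BoundaryData n} (hμ : IsDatum μ b)
    (hν : IsDatum ν b') : NullAsymptotic μ ν ↔ b = b' := by
  refine ⟨fun h => hμ.eq_of_nullAsymptotic hν h, ?_⟩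
  rintro rfl
  exact hμ.nullAsymptotic hν

/-- Reparametrizations of one geodesic are null asymptotic at distance zero, so invariance of the
datum needs no separate computation. -/
theorem IsDatum.of_toDirected_eq {μ ν : ParamGeodesic n} {b : BoundaryData n}
    (h : μ.toDirected = ν.toDirected) (hμ : IsDatum μ b) : IsDatum ν b := by
  obtain ⟨b', hν⟩ := exists_isDatum ν
  obtain ⟨a, c, ha, hac⟩ : (directedSetoid n).r ν μ := Quotient.exact h.symm
  have hnull : NullAsymptotic μ ν := by
    refine nullAsymptotic_of_tendsto (s := fun t => a * t + c)
      (tendsto_atTop_add_const_right _ _ (tendsto_id.const_mul_atTop ha)) ?_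
    simp only [hac, rho_self (ν.posDef _)]
    exact tendsto_const_nhds
  rw [(nullAsymptotic_iff hμ hν).1 hnull]
  exact hν

/-- Null asymptoticity is equality of data, hence an equivalence relation; the pencils are its
classes, and each contains its own geodesic. -/
theorem nullPencil_eq_iff {μ ν : ParamGeodesic n} {b b' : BoundaryData n} (hμ : IsDatum μ b)
    (hν : IsDatum ν b') : nullPencil μ = nullPencil ν ↔ b = b' := by
  constructor
  · intro h
    have hmem : ν.toDirected ∈ nullPencil ν := ⟨ν, rfl, (nullAsymptotic_iff hν hν).2 rfl⟩
    rw [← h] at hmem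
    obtain ⟨κ, hκ, hnull⟩ := hmem
    exact (nullAsymptotic_iff hμ (hν.of_toDirected_eq hκ.symm)).1 hnull
  · rintro rfl
    ext N
    refine exists_congr fun κ => and_congr_right fun _ => ?_
    obtain ⟨b', hκ⟩ := exists_isDatum κ
    rw [nullAsymptotic_iff hμ hκ, nullAsymptotic_iff hν hκ]

end PosDefSpace

end

theorem theorem3p9 (n : ℕ) :
    ∃ Φ : PosDefSpace.NullPencil n ≃ PosDefSpace.BoundaryData n,
      ∀ (μ : PosDefSpace.ParamGeodesic n) (b : PosDefSpace.BoundaryData n),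
        PosDefSpace.HasBoundaryData μ b ↔ Φ μ.toNullPencil = b := by
  -- The map takes the datum of a chosen representative of the pencil; `hval` shows that the choice
  -- is immaterial.
  choose datum hdatum using fun μ : PosDefSpace.ParamGeodesic n => PosDefSpace.exists_isDatum μ
  choose rep hrep using fun P : PosDefSpace.NullPencil n => P.2
  have hval : ∀ (μ : PosDefSpace.ParamGeodesic n), datum (rep μ.toNullPencil) = datum μ :=
    fun μ => (PosDefSpace.nullPencil_eq_iff (hdatum _) (hdatum _)).1 (hrep _)
  refine ⟨Equiv.ofBijective (fun P => datum (rep P)) ⟨fun P Q h => ?_, fun b => ?_⟩, fun μ b => ?_⟩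
  · refine Subtype.ext ?_
    rw [← hrep P, ← hrep Q]
    exact (PosDefSpace.nullPencil_eq_iff (hdatum _) (hdatum _)).2 h
  · obtain ⟨μ, hμ⟩ := PosDefSpace.exists_geodesic_of_datum b
    exact ⟨μ.toNullPencil, (hval μ).trans ((hdatum μ).unique hμ)⟩
  · change _ ↔ datum (rep μ.toNullPencil) = b
    rw [PosDefSpace.hasBoundaryData_iff, hval]
    exact ⟨fun h => (hdatum μ).unique h, fun h => h ▸ hdatum μ⟩
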